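/- Let $G=(V,E)$ be a locally finite simple undirected graph on a countable vertex set $V$, with vertex degree $\deg$, and let $q:V\to[0,\infty)$. On the complex Hilbert space $\ell^2(V)$ let $\Delta+q$ be the operator $$(\Delta+q)\varphi(v)=\sum_{w\sim v}(\varphi(v)-\varphi(w))+q(v)\varphi(v)$$ with domain the set of all $\varphi\in\ell^2(V)$ for which the right-hand side is in $\ell^2(V)$, and let $\deg+q$ be the operator of multiplication by the function $\deg+q$ with its maximal domain. Let $C_c(V)$ be the space of finitely supported functions. For operators $T_1,T_2$ defined on $C_c(V)$ we write $T_1\le T_2$ on $C_c(V)$ if $\langle T_1\varphi,\varphi\rangle\le\langle T_2\varphi,\varphi\rangle$ for all $\varphi\in C_c(V)$. For finite $W\subseteq V$ let $\partial W=\{(x,y)\in W\times(V\setminus W): x\sim y\}$ and $g(W)=\sum_{x\in W}g(x)$. For $U\subseteq V$ put $$\alpha_U=\inf_{\emptyset\ne W\subseteq U\text{ finite}}\frac{|\partial W|+q(W)}{\deg(W)+q(W)},$$ where the quotient is $0$ by convention if its denominator vanishes (and $\alpha_\emptyset:=0$), and let $$\alpha_\infty=\sup_{K\subseteq V\text{ finite}}\alpha_{V\setminus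 K}\in[0,1].$$ Assume $\alpha_\infty>0$. Then: (a) For every $\varepsilon>0$ there is $k_\varepsilon\ge0$ such that on $C_c(V)$ $$(1-\varepsilon)\Big(1-\sqrt{1-\alpha_\infty^2}\Big)(\deg+q)-k_\varepsilon\ \le\ \Delta+q\ \le\ (1+\varepsilon)\Big(1+\sqrt{1-\alpha_\infty^2}\Big)(\deg+q)+k_\varepsilon .$$ (b) The non-negative self-adjoint square roots of $\Delta+q$ and $\deg+q$ exist, and $\mathcal D((\Delta+q)^{1/2})=\mathcal D((\deg+q)^{1/2})$. (c) The operator $\Delta+q$ has purely discrete spectrum (that is, empty essential spectrum) if and only if $$\liminf_{|x|\to\infty}(\deg+q)(x):=\sup_{W\subseteq V\text{ finite}}\ \inf_{x\in V\setminus W}(\deg+q)(x)=\infty .$$ In this case, if additionally $\alpha_\infty=1$ and $V$ is infinite, then $$\lim_{n\to\infty}\frac{\lambda_n(\Delta+q)}{\lambda_n(\deg+q)}=1,$$ where $\lambda_0(T)\le\lambda_1(T)\le\dots$ denote the eigenvalues of $T$ below its essential spectrum in increasing order, counted with multiplicity (both sequences are infinite here). -/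

import Mathlib

open Filter Topology
open scoped lp

noncomputable section

namespace SchrodingerGraph

/-! ### Unbounded operators on a complex Hilbert space -/

section Operators

variable {H : Type*} [NormedAddCommGroup H] [InnerProductSpace ℂ H]

/-- `S` is the non-negative self-adjoint square root of `T`: it is self-adjoint, non-negative, and
`S ∘ S = T` as partially defined operators (the domain of `S ∘ S` consists of the `x ∈ D(S)` with
`S x ∈ D(S)`). -/
structure IsPosSqrt [CompleteSpace H] (S T : H →ₗ.[ℂ] H) : Prop where
  isSelfAdjoint : IsSelfAdjoint S
  nonneg : ∀ x : S.domain, 0 ≤ (inner ℂ (x : H) (S x)).re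
  mem_graph_iff : ∀ x y : H, (x, y) ∈ T.graph ↔ ∃ z : H, (x, z) ∈ S.graph ∧ (z, y) ∈ S.graph

/-- `T₁ ≤ T₂` on the subspace `D₀` in the sense of forms: `D₀` is contained in both domains and
`⟨T₁ φ, φ⟩ ≤ ⟨T₂ φ, φ⟩` for all `φ ∈ D₀`. -/
def FormLE (D₀ : Submodule ℂ H) (T₁ T₂ : H →ₗ.[ℂ] H) : Prop :=
  ∀ φ ∈ D₀, ∃ (h₁ : φ ∈ T₁.domain) (h₂ : φ ∈ T₂.domain),
    (inner ℂ (T₁ ⟨φ, h₁⟩) φ).re ≤ (inner ℂ (T₂ ⟨φ, h₂⟩) φ).re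

/-- The operator `c T + k`, with the domain of `T`, for real constants `c` and `k`. -/
def affine (c : ℝ) (T : H →ₗ.[ℂ] H) (k : ℝ) : H →ₗ.[ℂ] H where
  domain := T.domain
  toFun := (c : ℂ) • T.toFun + (k : ℂ) • T.domain.subtype

/-- The resolvent set: those `z` for which `T - z : D(T) → H` has a bounded inverse defined on all
of `H`. -/
def opResolventSet (T : H →ₗ.[ℂ] H) : Set ℂ :=
  {z | ∃ R : H →L[ℂ] H,
    (∀ y : H, ∃ h : R y ∈ T.domain, T ⟨R y, h⟩ - z • R y = y) ∧
    ∀ x : T.domain, R (T x - z • (x : H)) = x}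

/-- The spectrum of an unbounded operator. -/
def opSpectrum (T : H →ₗ.[ℂ] H) : Set ℂ := (opResolventSet T)ᶜ

/-- The eigenspace `{x ∈ D(T) | T x = z x}`. -/
def opEigenspace (T : H →ₗ.[ℂ] H) (z : ℂ) : Submodule ℂ H :=
  T.graph.comap (LinearMap.prod LinearMap.id (z • LinearMap.id))

/-- The discrete spectrum: the isolated points of the spectrum that are eigenvalues of finite
multiplicity. -/
def discreteSpectrum (T : H →ₗ.[ℂ] H) : Set ℂ :=
  {z | z ∈ opSpectrum T ∧ (∀ᶠ w in 𝓝[≠] z, w ∉ opSpectrum T) ∧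
    opEigenspace T z ≠ ⊥ ∧ FiniteDimensional ℂ (opEigenspace T z)}

/-- The essential spectrum: the complement of the discrete spectrum in the spectrum. -/
def essentialSpectrum (T : H →ₗ.[ℂ] H) : Set ℂ := opSpectrum T \ discreteSpectrum T

/-- The spectrum is purely discrete when the essential spectrum is empty. -/
def HasPurelyDiscreteSpectrum (T : H →ₗ.[ℂ] H) : Prop := essentialSpectrum T = ∅

/-- `ev 0 ≤ ev 1 ≤ …` lists the (real) eigenvalues of `T` below the essential spectrum, in
increasing order and counted with multiplicity; in particular there are infinitely many of them. -/
structure IsEigenvalueSequence (T : H →ₗ.[ℂ] H) (ev : ℕ → ℝ) : Prop where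
  monotone : Monotone ev
  below : ∀ n, ∀ s ∈ essentialSpectrum T, ev n < s.re
  multiplicity : ∀ t : ℝ, (∀ s ∈ essentialSpectrum T, t < s.re) →
    {n | ev n = t}.encard = Cardinal.toENat (Module.rank ℂ (opEigenspace T (t : ℂ)))

end Operators

/-! ### Operators on `ℓ²(V)` -/

section EllTwo

variable {V : Type*}

/-- The finitely supported functions, as a subspace of `ℓ²(V)`. -/
def Cc (V : Type*) : Submodule ℂ ℓ²(V, ℂ) where
  carrier := {φ | (Function.support (φ : V → ℂ)).Finite}
  add_mem' := by
    intro a b ha hb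
    exact (Set.Finite.union ha hb).subset (Function.support_add (a : V → ℂ) (b : V → ℂ))
  zero_mem' := by
    show (Function.support (0 : V → ℂ)).Finite
    simp
  smul_mem' := by
    intro c a ha
    exact Set.Finite.subset ha (Function.support_const_smul_subset c (a : V → ℂ))

/-- The operator on `ℓ²(V)` given by a linear map `L` on functions, with maximal domain
`{φ ∈ ℓ²(V) | L φ ∈ ℓ²(V)}`. -/
def maximalOperator (L : (V → ℂ) →ₗ[ℂ] (V → ℂ)) : ℓ²(V, ℂ) →ₗ.[ℂ] ℓ²(V, ℂ) where
  domain :=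
    { carrier := {φ | Memℓp (L (φ : V → ℂ)) 2}
      add_mem' := by
        intro a b ha hb
        show Memℓp (L ((a : V → ℂ) + (b : V → ℂ))) 2
        rw [map_add]
        exact Memℓp.add ha hb
      zero_mem' := by
        show Memℓp (L (0 : V → ℂ)) 2
        rw [map_zero]
        exact zero_memℓp
      smul_mem' := by
        intro c a ha
        show Memℓp (L (c • (a : V → ℂ))) 2
        rw [map_smul]
        exact Memℓp.const_smul ha c }
  toFun :=
    { toFun := fun φ => ⟨L ((φ : ℓ²(V, ℂ)) : V → ℂ), φ.2⟩
      map_add' := by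
        intro a b
        ext x
        exact congrFun (map_add L ((a : ℓ²(V, ℂ)) : V → ℂ) ((b : ℓ²(V, ℂ)) : V → ℂ)) x
      map_smul' := by
        intro c a
        ext x
        exact congrFun (map_smul L c ((a : ℓ²(V, ℂ)) : V → ℂ)) x }

end EllTwo

/-! ### Schrödinger operators on locally finite graphs and Cheeger constants -/

section Graphs

variable {V : Type*} (G : SimpleGraph V) [G.LocallyFinite] (q : V → ℝ)

/-- The function `deg + q`. -/
def degPot (x : V) : ℝ := (G.degree x : ℝ) + q x

/-- The formal Schrödinger operator `f ↦ (v ↦ ∑_{w ∼ v} (f v - f w) + q v f v)`. -/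
def formalSchrodinger : (V → ℂ) →ₗ[ℂ] (V → ℂ) where
  toFun f v := ∑ w ∈ G.neighborFinset v, (f v - f w) + (q v : ℂ) * f v
  map_add' f g := by
    funext v
    simp only [Pi.add_apply, mul_add, add_sub_add_comm, Finset.sum_add_distrib]
    ring
  map_smul' c f := by
    funext v
    simp only [Pi.smul_apply, smul_eq_mul, RingHom.id_apply, mul_add, Finset.mul_sum, mul_sub]
    ring

/-- Multiplication by the real function `g`. -/
def formalMul (g : V → ℝ) : (V → ℂ) →ₗ[ℂ] (V → ℂ) where
  toFun f v := (g v : ℂ) * f v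
  map_add' f h := by
    funext v
    simp [mul_add]
  map_smul' c f := by
    funext v
    simp [mul_left_comm]

/-- The Schrödinger operator `Δ + q` on `ℓ²(V)`. -/
def schrodinger : ℓ²(V, ℂ) →ₗ.[ℂ] ℓ²(V, ℂ) := maximalOperator (formalSchrodinger G q)

/-- The operator of multiplication by `deg + q` on `ℓ²(V)`. -/
def degOperator : ℓ²(V, ℂ) →ₗ.[ℂ] ℓ²(V, ℂ) := maximalOperator (formalMul (degPot G q))

/-- The boundary of `W`: the directed edges from `W` to its complement. -/
def edgeBoundary (W : Finset V) : Set (V × V) := {p | p.1 ∈ W ∧ p.2 ∉ W ∧ G.Adj p.1 p.2}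

/-- The quotient `(|∂W| + q(W)) / (deg(W) + q(W))`, equal to `0` if the denominator vanishes. -/
def cheegerQuotient (W : Finset V) : ℝ :=
  (((edgeBoundary G W).ncard : ℝ) + ∑ x ∈ W, q x) / ∑ x ∈ W, degPot G q x

/-- The Cheeger constant of `U`: the infimum of the quotients over the finite non-empty subsets
of `U`. -/
def cheegerConst (U : Set V) : ℝ :=
  sInf {r | ∃ W : Finset V, W.Nonempty ∧ (W : Set V) ⊆ U ∧ r = cheegerQuotient G q W}

/-- The Cheeger constant at infinity: the supremum of the Cheeger constants of the complements of
finite sets. -/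
def cheegerInfty : ℝ := ⨆ K : Finset V, cheegerConst G q ((K : Set V)ᶜ)

/-- `liminf_{|x| → ∞} g(x)`, the supremum over finite `W` of the infimum of `g` off `W`, taken in
the extended reals. -/
def liminfInfty (g : V → ℝ) : EReal := ⨆ W : Finset V, ⨅ x : {x : V // x ∉ W}, ((g x : ℝ) : EReal)

end Graphs

end SchrodingerGraph

end

open SchrodingerGraph

namespace SchrodingerGraph

open scoped InnerProductSpace

section AbstractOperators

variable {H : Type*} [NormedAddCommGroup H] [InnerProductSpace ℂ H]

/-! ### The resolvent at `-1` of a non-negative self-adjoint operator -/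

/-! Write `D = deg + q`. The operator `Δ + q` is `D` minus the adjacency matrix, so the form
comparison reduces to bounding the adjacency form by the form of `D`. Cheeger's argument
(`sum_mul_min_le`, `sum_mul_mul_le_sqrt`) turns the isoperimetric constant `β` of the complement of
a finite set `K` into the factor `√(1 - β²)`; pairs of vertices meeting `K` contribute only a
bounded form. Since `β` can be taken arbitrarily close to the Cheeger constant at infinity,
continuity gives (a) (`exists_form_bounds`).

The unbounded operators are handled through `R = (T + 1)⁻¹`. A vector orthogonal to `(T + 1) C_c` is
an eigenvector of the maximal operator for `-1`, and there is none: for `Δ + q` by the maximum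
principle, since the modulus of an `ℓ²` function attains its maximum. Hence `R` exists. The square
root of `T` is the operator `R^{1/2} u ↦ (1 - R)^{1/2} u`, for which `C_c` is a core, so form bounds
on `C_c` in both directions give (b).

For (c), the spectrum of `T` is purely discrete exactly when `R` is compact. If `R` is compact, only
finitely many standard basis vectors are images under `R` of vectors of bounded norm, which makes
the sublevel sets of `D` finite. Conversely, finite sublevel sets and the lower form bound make `R`
a norm limit of finite-rank operators. When the Cheeger constant at infinity is `1`, both form
constants are `1 ± ε`, and a min-max comparison of the eigenvectors of `Δ + q` with the standard
basis gives the asymptotics. -/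

/-- `R` is the bounded inverse of `T + 1`, and `0 ≤ R ≤ 1`; equivalently, `T` is self-adjoint and
non-negative with `R = (T + 1)⁻¹`. -/
structure IsNegOneResolvent (T : H →ₗ.[ℂ] H) (R : H →L[ℂ] H) : Prop where
  nonneg : 0 ≤ R
  le_one : R ≤ 1
  mem_graph_iff : ∀ x y : H, (x, y) ∈ T.graph ↔ R (x + y) = x

namespace IsNegOneResolvent

variable {T : H →ₗ.[ℂ] H} {R : H →L[ℂ] H}

theorem isSymmetric (h : IsNegOneResolvent T R) (x y : H) : ⟪R x, y⟫_ℂ = ⟪x, R y⟫_ℂ :=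
  ((ContinuousLinearMap.nonneg_iff_isPositive R).1 h.nonneg).isSymmetric x y

theorem re_inner_nonneg (h : IsNegOneResolvent T R) (x : H) : 0 ≤ (⟪R x, x⟫_ℂ).re :=
  ((ContinuousLinearMap.nonneg_iff_isPositive R).1 h.nonneg).2 x

theorem mem_graph (h : IsNegOneResolvent T R) (u : H) : (R u, u - R u) ∈ T.graph := by
  rw [h.mem_graph_iff]; congr 1; abel

theorem eq_zero_of_apply_eq_zero (h : IsNegOneResolvent T R) {u : H} (hu : R u = 0) : u = 0 := by
  have := h.mem_graph u
  rw [hu, sub_zero] at this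
  exact LinearPMap.graph_fst_eq_zero_snd T this rfl

theorem inner_symm (h : IsNegOneResolvent T R) {x y x' y' : H} (hx : (x, y) ∈ T.graph)
    (hx' : (x', y') ∈ T.graph) : ⟪y, x'⟫_ℂ = ⟪x, y'⟫_ℂ := by
  rw [h.mem_graph_iff] at hx hx'
  have := h.isSymmetric (x + y) (x' + y')
  rw [hx, hx', inner_add_left, inner_add_right] at this
  exact (add_left_cancel this).symm

end IsNegOneResolvent

/-- The operator with graph `{(B u, C u)}`, where `B` is injective. -/
noncomputable def graphOperator (B C : H →L[ℂ] H) : H →ₗ.[ℂ] H :=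
  (LinearMap.range ((B : H →ₗ[ℂ] H).prod (C : H →ₗ[ℂ] H))).toLinearPMap

theorem mem_graphOperator_iff {B C : H →L[ℂ] H} (hB : ∀ u, B u = 0 → u = 0) (x y : H) :
    (x, y) ∈ (graphOperator B C).graph ↔ ∃ u, B u = x ∧ C u = y := by
  rw [graphOperator, Submodule.toLinearPMap_graph_eq]
  · simp [Prod.ext_iff]
  · rintro ⟨a, b⟩ ⟨u, hu⟩ ha
    have h1 : B u = a := congrArg Prod.fst hu
    have h2 : C u = b := congrArg Prod.snd hu
    have : u = 0 := hB u (h1.trans ha)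
    simp [← h2, this]

variable [CompleteSpace H]

/-- A closed operator `T` that is symmetric and non-negative on a subspace `C` with `(T + 1) C`
dense, and for which `-1` is not an eigenvalue, has a resolvent at `-1`. -/
theorem exists_isNegOneResolvent {T : H →ₗ.[ℂ] H} {C : Submodule ℂ H} (A : C →ₗ[ℂ] H)
    (hA : ∀ φ : C, ((φ : H), A φ) ∈ T.graph)
    (hsymm : ∀ φ ψ : C, ⟪A φ, (ψ : H)⟫_ℂ = ⟪(φ : H), A ψ⟫_ℂ)
    (hnonneg : ∀ φ : C, 0 ≤ (⟪A φ, (φ : H)⟫_ℂ).re)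
    (hdense : DenseRange (fun φ : C => (φ : H) + A φ))
    (hclosed : IsClosed (T.graph : Set (H × H)))
    (hinj : ∀ x, (x, -x) ∈ T.graph → x = 0) :
    ∃ R : H →L[ℂ] H, IsNegOneResolvent T R := by
  set B : C →ₗ[ℂ] H := C.subtype + A with hB
  have hBapp : ∀ φ, B φ = (φ : H) + A φ := fun φ => rfl
  have hdB : DenseRange B := hdense
  -- Non-negativity of `A` gives `‖φ‖² ≤ ⟪(A + 1) φ, φ⟫`, so the inverse of `A + 1` is a contraction
  -- and extends from its dense domain to all of `H`.
  have hnorm : ∀ φ, ‖C.subtype φ‖ ≤ 1 * ‖B φ‖ := by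
    intro φ
    rw [one_mul]
    rcases eq_or_ne ((φ : H)) 0 with h0 | h0
    · simp [h0]
    have h1 : ‖(φ : H)‖ ^ 2 ≤ (⟪B φ, (φ : H)⟫_ℂ).re := by
      rw [hBapp, inner_add_left, Complex.add_re, ← @inner_self_eq_norm_sq ℂ]
      have := hnonneg φ
      simp only [RCLike.re_to_complex]
      linarith
    have h2 : (⟪B φ, (φ : H)⟫_ℂ).re ≤ ‖B φ‖ * ‖(φ : H)‖ := re_inner_le_norm (𝕜 := ℂ) _ _
    have h3 : 0 < ‖(φ : H)‖ := norm_pos_iff.2 h0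
    have : ‖(φ : H)‖ * ‖(φ : H)‖ ≤ ‖B φ‖ * ‖(φ : H)‖ := by nlinarith
    exact le_of_mul_le_mul_right this h3
  set R : H →L[ℂ] H := C.subtype.extendOfNorm B with hRdef
  have hR : ∀ φ : C, R (B φ) = φ := fun φ => LinearMap.extendOfNorm_eq hdB ⟨1, hnorm⟩ φ
  have hRsymm : ∀ x y, ⟪R x, y⟫_ℂ = ⟪x, R y⟫_ℂ := by
    intro x y
    refine hdB.induction_on₂ (p := fun x y => ⟪R x, y⟫_ℂ = ⟪x, R y⟫_ℂ) ?_ ?_ x y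
    · exact isClosed_eq (by fun_prop) (by fun_prop)
    · intro φ ψ
      rw [hR, hR, hBapp, hBapp, inner_add_left, inner_add_right, hsymm]
  refine ⟨R, ?_, ?_, ?_⟩
  · rw [ContinuousLinearMap.nonneg_iff_isPositive]
    refine ⟨hRsymm, fun x => ?_⟩
    refine hdB.induction_on (p := fun x => 0 ≤ R.reApplyInnerSelf x) x ?_ ?_
    · exact isClosed_le continuous_const R.reApplyInnerSelf_continuous
    · intro φ
      rw [ContinuousLinearMap.reApplyInnerSelf_apply, hR, hBapp, inner_add_right, ← hsymm,
        map_add]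
      exact add_nonneg inner_self_nonneg (hnonneg φ)
  · rw [ContinuousLinearMap.le_def]
    refine ⟨fun x y => ?_, fun x => ?_⟩
    · change ⟪x - R x, y⟫_ℂ = ⟪x, y - R y⟫_ℂ
      rw [inner_sub_left, inner_sub_right, hRsymm]
    refine hdB.induction_on (p := fun x => 0 ≤ (1 - R).reApplyInnerSelf x) x ?_ ?_
    · exact isClosed_le continuous_const (1 - R).reApplyInnerSelf_continuous
    · intro φ
      rw [ContinuousLinearMap.reApplyInnerSelf_apply]
      change 0 ≤ RCLike.re ⟪B φ - R (B φ), B φ⟫_ℂ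
      rw [hR, hBapp, add_sub_cancel_left, inner_add_right, map_add]
      exact add_nonneg (hnonneg φ) inner_self_nonneg
  · have key : ∀ u, (R u, u - R u) ∈ T.graph := by
      intro u
      refine hdB.induction_on (p := fun u => (R u, u - R u) ∈ T.graph) u ?_ ?_
      · exact hclosed.preimage (f := fun u => (R u, u - R u)) (by fun_prop)
      · intro φ
        rw [hR, hBapp, add_sub_cancel_left]
        exact hA φ
    intro x y
    constructor
    · intro hxy
      -- The difference of the two graph elements has the form `(d, -d)`, so it vanishes because
      -- `-1` is not an eigenvalue.
      have h1 := T.graph.sub_mem hxy (key (x + y))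
      have h2 := hinj (x - R (x + y)) (by
        convert h1 using 1
        simp only [Prod.mk_sub_mk, Prod.mk.injEq, true_and]
        abel)
      exact (sub_eq_zero.1 h2).symm
    · intro h
      have := key (x + y)
      rwa [h, add_sub_cancel_left] at this

/-! ### Square roots -/

/-- A densely defined operator whose graph is its own adjoint relation is self-adjoint. -/
theorem isSelfAdjoint_of_mem_graph_iff {S : H →ₗ.[ℂ] H} (hS : Dense (S.domain : Set H))
    (h : ∀ u v : H, (u, v) ∈ S.graph ↔ ∀ a b, (a, b) ∈ S.graph → ⟪b, u⟫_ℂ = ⟪a, v⟫_ℂ) :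
    IsSelfAdjoint S := by
  rw [LinearPMap.isSelfAdjoint_def]
  apply LinearPMap.eq_of_eq_graph
  rw [LinearPMap.adjoint_graph_eq_graph_adjoint hS]
  ext ⟨u, v⟩
  rw [Submodule.mem_adjoint_iff, h]
  simp only [sub_eq_zero]

/-- Formally `T = (1 - R) / R`, so the root is `C / B` with `B = √R` and `C = √(1 - R)`, realised as
the operator with graph `{(B u, C u)}`. What makes it work is that `B` and `C` commute and `B² + C²
= 1`. -/
theorem exists_isPosSqrt {T : H →ₗ.[ℂ] H} {R : H →L[ℂ] H} (h : IsNegOneResolvent T R) :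
    ∃ S, IsPosSqrt S T := by
  set B := CFC.sqrt R with hB
  set C := CFC.sqrt (1 - R) with hC
  have h1R : 0 ≤ 1 - R := sub_nonneg.2 h.le_one
  have hBB : ∀ u, B (B u) = R u := fun u => by
    have := CFC.sqrt_mul_sqrt_self R h.nonneg
    exact congrArg (fun F : H →L[ℂ] H => F u) this
  have hCC : ∀ u, C (C u) = u - R u := fun u => by
    have := CFC.sqrt_mul_sqrt_self (1 - R) h1R
    exact congrArg (fun F : H →L[ℂ] H => F u) this
  have hRC : Commute R C := by
    rw [hC, CFC.sqrt_eq_cfc]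
    exact ((Commute.one_left R).sub_left (Commute.refl R)).cfc_nnreal _ |>.symm
  have hcomm : Commute B C := by
    rw [hB, CFC.sqrt_eq_cfc]
    exact hRC.cfc_nnreal _
  have hBC : ∀ u, B (C u) = C (B u) := fun u =>
    congrArg (fun F : H →L[ℂ] H => F u) hcomm
  have hBpos : 0 ≤ B := CFC.sqrt_nonneg R
  have hCpos : 0 ≤ C := CFC.sqrt_nonneg (1 - R)
  have hBCpos : 0 ≤ B * C := hcomm.mul_nonneg hBpos hCpos
  rw [ContinuousLinearMap.nonneg_iff_isPositive] at hBpos hCpos hBCpos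
  have hBs : ∀ x y, ⟪B x, y⟫_ℂ = ⟪x, B y⟫_ℂ := hBpos.isSymmetric
  have hCs : ∀ x y, ⟪C x, y⟫_ℂ = ⟪x, C y⟫_ℂ := hCpos.isSymmetric
  have hBinj : ∀ u, B u = 0 → u = 0 := fun u hu =>
    h.eq_zero_of_apply_eq_zero (by rw [← hBB, hu, map_zero])
  have hgr := fun x y => mem_graphOperator_iff (C := C) hBinj x y
  have hdense : Dense ((graphOperator B C).domain : Set H) := by
    rw [Submodule.dense_iff_topologicalClosure_eq_top, Submodule.topologicalClosure_eq_top_iff,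
      Submodule.eq_bot_iff]
    intro x hx
    apply hBinj
    have hm : B (B x) ∈ (graphOperator B C).domain :=
      LinearPMap.mem_domain_of_mem_graph ((hgr _ _).2 ⟨B x, rfl, rfl⟩)
    have := (Submodule.mem_orthogonal _ _).1 hx _ hm
    rw [hBs] at this
    exact inner_self_eq_zero.1 this
  -- The relation `C x = B y` characterises the graph; the parameter is `u = B x + C y` because `B²
  -- + C² = 1`. This gives maximality of the symmetric operator and also computes its square.
  have hsplit : ∀ x y, C x = B y → ∃ u, B u = x ∧ C u = y := by
    intro x y hxy
    refine ⟨B x + C y, ?_, ?_⟩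
    · rw [map_add, hBC, ← hxy, hBB, hCC]; abel
    · rw [map_add, ← hBC, hxy, hBB, hCC]; abel
  refine ⟨graphOperator B C, isSelfAdjoint_of_mem_graph_iff hdense ?_, ?_, ?_⟩
  · intro u v
    rw [hgr]
    constructor
    · rintro ⟨w, rfl, rfl⟩ a b hab
      obtain ⟨z, rfl, rfl⟩ := (hgr _ _).1 hab
      rw [hCs, hBs, hBC]
    · intro hab
      refine hsplit u v ?_
      refine ext_inner_left ℂ fun z => ?_
      rw [← hCs, ← hBs]
      exact hab _ _ ((hgr _ _).2 ⟨z, rfl, rfl⟩)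
  · intro x
    obtain ⟨u, hu, hu'⟩ := (hgr _ _).1 ((graphOperator B C).mem_graph x)
    rw [← hu, ← hu', hBs]
    have := hBCpos.2 u
    rwa [ContinuousLinearMap.reApplyInnerSelf_apply, inner_re_symm] at this
  · intro x y
    rw [h.mem_graph_iff]
    constructor
    · intro hxy
      refine ⟨C (B (x + y)), (hgr _ _).2 ⟨B (x + y), ?_, rfl⟩, (hgr _ _).2 ⟨C (x + y), ?_, ?_⟩⟩
      · rw [hBB, hxy]
      · rw [hBC]
      · rw [hCC, hxy, add_sub_cancel_left]
    · rintro ⟨z, hxz, hzy⟩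
      obtain ⟨a, rfl, rfl⟩ := (hgr _ _).1 hxz
      obtain ⟨b, hb, rfl⟩ := (hgr _ _).1 hzy
      obtain ⟨u, rfl, rfl⟩ := hsplit a b hb.symm
      rw [hBB, hCC, add_sub_cancel]

/-- If `C` is a form core of `T₁`, and the form of `T₂` is bounded on `C` by the form of `T₁` plus
a constant, then the form domain of `T₁` is contained in that of `T₂`. -/
theorem IsPosSqrt.domain_le {T₁ T₂ S₁ S₂ : H →ₗ.[ℂ] H} (h₁ : IsPosSqrt S₁ T₁)
    (h₂ : IsPosSqrt S₂ T₂) {C : Submodule ℂ H} (A₁ A₂ : C →ₗ[ℂ] H)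
    (hA₁ : ∀ φ : C, ((φ : H), A₁ φ) ∈ T₁.graph) (hA₂ : ∀ φ : C, ((φ : H), A₂ φ) ∈ T₂.graph)
    (hdense : DenseRange (fun φ : C => (φ : H) + A₁ φ)) {M : ℝ} (hM : 0 ≤ M)
    (hle : ∀ φ : C, (⟪A₂ φ, (φ : H)⟫_ℂ).re ≤ M * ((⟪A₁ φ, (φ : H)⟫_ℂ).re + ‖(φ : H)‖ ^ 2)) :
    S₁.domain ≤ S₂.domain := by
  have hsym : ∀ {S : H →ₗ.[ℂ] H}, IsSelfAdjoint S → ∀ {a b c d : H}, (a, b) ∈ S.graph →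
      (c, d) ∈ S.graph → ⟪b, c⟫_ℂ = ⟪a, d⟫_ℂ := by
    intro S hS a b c d hab hcd
    have hg := LinearPMap.adjoint_graph_eq_graph_adjoint hS.dense_domain
    rw [LinearPMap.isSelfAdjoint_def.1 hS] at hg
    rw [hg, Submodule.mem_adjoint_iff] at hcd
    exact sub_eq_zero.1 (hcd a b hab)
  have hex : ∀ {S T : H →ₗ.[ℂ] H} (A : C →ₗ[ℂ] H), IsPosSqrt S T →
      (∀ φ : C, ((φ : H), A φ) ∈ T.graph) → ∃ B : C →ₗ[ℂ] H, ∀ φ : C, ((φ : H), B φ) ∈ S.graph ∧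
        (B φ, A φ) ∈ S.graph := by
    intro S T A hS hA
    have hdom : C ≤ S.domain := by
      intro φ hφ
      obtain ⟨z, hz, -⟩ := (hS.mem_graph_iff _ _).1 (hA ⟨φ, hφ⟩)
      exact LinearPMap.mem_domain_of_mem_graph hz
    refine ⟨S.toFun ∘ₗ Submodule.inclusion hdom, fun φ => ?_⟩
    obtain ⟨z, hz, hz'⟩ := (hS.mem_graph_iff _ _).1 (hA φ)
    have h1 : ((φ : H), (S.toFun ∘ₗ Submodule.inclusion hdom) φ) ∈ S.graph :=
      S.mem_graph (Submodule.inclusion hdom φ)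
    have h2 := LinearPMap.mem_graph_snd_inj S h1 hz rfl
    rw [h2]
    exact ⟨hz, hz'⟩
  obtain ⟨B₁, hB₁⟩ := hex A₁ h₁ hA₁
  obtain ⟨B₂, hB₂⟩ := hex A₂ h₂ hA₂
  have hsq : ∀ {S T : H →ₗ.[ℂ] H} (_ : IsPosSqrt S T) {A B : C →ₗ[ℂ] H} (_ : ∀ φ : C,
      ((φ : H), B φ) ∈ S.graph ∧ (B φ, A φ) ∈ S.graph) (φ : C),
      (⟪A φ, (φ : H)⟫_ℂ).re = ‖B φ‖ ^ 2 := by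
    intro S T hS A B hB φ
    rw [hsym hS.isSelfAdjoint (hB φ).2 (hB φ).1, ← @inner_self_eq_norm_sq ℂ]
    rfl
  intro x hx
  set E := WithLp 2 (H × H)
  set J : C →ₗ[ℂ] E := (WithLp.linearEquiv 2 ℂ (H × H)).symm.toLinearMap ∘ₗ
    (C.subtype.prod B₁) with hJ
  -- `C` is a core of `S₁`: project onto the closure of `{(φ, S₁ φ)}` in `H ⊕ H`. The remainder `r`
  -- lies in the graph of `S₁`, and its orthogonality to `(φ, S₁ φ)` reads `⟪φ + A₁ φ, r.1⟫ = 0`, so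
  -- density kills it.
  have hcore : ((WithLp.toLp 2 (x, S₁ ⟨x, hx⟩)) : E) ∈ (LinearMap.range J).topologicalClosure := by
    have hcl : IsClosed (S₁.graph : Set (H × H)) := h₁.isSelfAdjoint.isClosed
    set K := (LinearMap.range J).topologicalClosure with hK
    have : CompleteSpace K := (Submodule.isClosed_topologicalClosure _).completeSpace_coe
    obtain ⟨p, hp, r, hr, hpr⟩ := K.exists_add_mem_mem_orthogonal
      ((WithLp.toLp 2 (x, S₁ ⟨x, hx⟩)) : E)
    have hKle : ∀ p ∈ K, WithLp.ofLp p ∈ S₁.graph := by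
      intro p hp
      have hcl' : IsClosed {p : E | WithLp.ofLp p ∈ S₁.graph} :=
        hcl.preimage (WithLp.prod_continuous_ofLp 2 H H)
      refine (closure_minimal ?_ hcl') hp
      rintro _ ⟨φ, rfl⟩
      exact (hB₁ φ).1
    have hr0 : WithLp.ofLp r ∈ S₁.graph := by
      have : r = WithLp.toLp 2 (x, S₁ ⟨x, hx⟩) - p := by rw [hpr]; abel
      rw [this]
      exact S₁.graph.sub_mem (S₁.mem_graph ⟨x, hx⟩) (hKle p hp)
    have hfst : (WithLp.ofLp r).1 = 0 := by
      refine hdense.induction_on (p := fun z => ⟪z, (WithLp.ofLp r).1⟫_ℂ = 0) _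
        (isClosed_eq (by fun_prop) (by fun_prop)) (fun φ => ?_) |> inner_self_eq_zero.1
      have h0 : ⟪J φ, r⟫_ℂ = 0 := (Submodule.mem_orthogonal _ _).1 hr _
        (Submodule.le_topologicalClosure _ ⟨φ, rfl⟩)
      rw [WithLp.prod_inner_apply] at h0
      rw [inner_add_left, hsym h₁.isSelfAdjoint (hB₁ φ).2 hr0]
      exact h0
    have hsnd : (WithLp.ofLp r).2 = 0 := LinearPMap.graph_fst_eq_zero_snd S₁ hr0 hfst
    have hr00 : r = 0 := by
      apply (WithLp.ofLp_injective 2)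
      exact Prod.ext hfst hsnd
    rw [hpr, hr00, add_zero]
    exact hp
  obtain ⟨s, hs, hslim⟩ := mem_closure_iff_seq_limit.1 hcore
  choose φ hφ using hs
  have hlim : Tendsto (fun n => WithLp.ofLp (s n)) atTop (𝓝 (x, S₁ ⟨x, hx⟩)) :=
    ((WithLp.prod_continuous_ofLp 2 H H).tendsto _).comp hslim
  have hl1 : Tendsto (fun n => ((φ n : C) : H)) atTop (𝓝 x) := by
    have := (continuous_fst.tendsto _).comp hlim
    refine this.congr fun n => ?_
    simp [← hφ, hJ]
  have hl2 : Tendsto (fun n => B₁ (φ n)) atTop (𝓝 (S₁ ⟨x, hx⟩)) := by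
    have := (continuous_snd.tendsto _).comp hlim
    refine this.congr fun n => ?_
    simp [← hφ, hJ]
  have hbound : ∀ ψ : C, ‖B₂ ψ‖ ≤ √M * (‖B₁ ψ‖ + ‖(ψ : H)‖) := by
    intro ψ
    have := hle ψ
    rw [hsq h₂ hB₂, hsq h₁ hB₁] at this
    refine abs_le_of_sq_le_sq' ?_ (by positivity) |>.2
    rw [mul_pow, Real.sq_sqrt hM]
    refine this.trans (mul_le_mul_of_nonneg_left ?_ hM)
    nlinarith [norm_nonneg (B₁ ψ), norm_nonneg (ψ : H)]
  -- The form bound makes `S₂` continuous on `C` for the graph norm of `S₁`; closedness of `S₂` then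
  -- puts the limit `x` in its domain.
  have hcau : CauchySeq (fun n => B₂ (φ n)) := by
    have c1 := hl1.cauchySeq
    have c2 := hl2.cauchySeq
    rw [Metric.cauchySeq_iff] at c1 c2 ⊢
    intro ε hε
    set δ := ε / (2 * (√M + 1)) with hδ
    have hMp : 0 < √M + 1 := by positivity
    have hδp : 0 < δ := by positivity
    obtain ⟨N₁, hN₁⟩ := c1 δ hδp
    obtain ⟨N₂, hN₂⟩ := c2 δ hδp
    refine ⟨max N₁ N₂, fun m hm n hn => ?_⟩
    have e1 := hN₁ m (le_trans (le_max_left _ _) hm) n (le_trans (le_max_left _ _) hn)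
    have e2 := hN₂ m (le_trans (le_max_right _ _) hm) n (le_trans (le_max_right _ _) hn)
    rw [dist_eq_norm] at e1 e2 ⊢
    have e3 := hbound (φ m - φ n)
    rw [map_sub, map_sub, Submodule.coe_sub] at e3
    have e4 : √M * (‖B₁ (φ m) - B₁ (φ n)‖ + ‖(φ m : H) - φ n‖) ≤ √M * (δ + δ) := by gcongr
    have e5 : √M * (δ + δ) < (√M + 1) * (δ + δ) := by nlinarith
    have e6 : (√M + 1) * (δ + δ) = ε := by rw [hδ]; field_simp; ring
    linarith
  obtain ⟨y, hy⟩ := cauchySeq_tendsto_of_complete hcau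
  have hcl : IsClosed (S₂.graph : Set (H × H)) := h₂.isSelfAdjoint.isClosed
  have : (x, y) ∈ S₂.graph :=
    hcl.mem_of_tendsto (hl1.prodMk_nhds hy) (Eventually.of_forall fun n => (hB₂ (φ n)).1)
  exact LinearPMap.mem_domain_of_mem_graph this

end AbstractOperators

section CompactResolvent

variable {H : Type*} [NormedAddCommGroup H] [InnerProductSpace ℂ H]

/-! ### Compact resolvents -/

theorem mem_opEigenspace_iff {T : H →ₗ.[ℂ] H} {z : ℂ} {x : H} :
    x ∈ opEigenspace T z ↔ (x, z • x) ∈ T.graph := Iff.rfl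

/-- A compact operator maps only finitely many vectors of a bounded family to an orthonormal
family. -/
theorem finite_of_orthonormal_image {R : H →L[ℂ] H} (hR : IsCompactOperator R) {ι : Type*}
    {b : ι → H} (hb : Orthonormal ℂ b) (v : ι → H) {S : Set ι} {M : ℝ}
    (hv : ∀ i ∈ S, ‖v i‖ ≤ M) (hRv : ∀ i ∈ S, R (v i) = b i) : S.Finite := by
  by_contra hS
  have hS : S.Infinite := hS
  set g : ℕ → ι := fun n => (hS.natEmbedding S n : ι) with hg
  have hgS : ∀ n, g n ∈ S := fun n => (hS.natEmbedding S n).2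
  have hginj : Function.Injective g := fun m n h =>
    (hS.natEmbedding S).injective (Subtype.ext h)
  obtain ⟨K, hK, hK'⟩ := hR.image_closedBall_subset_compact (f := (R : H →ₗ[ℂ] H)) M
  obtain ⟨y, -, ψ, hψ, hψy⟩ := hK.tendsto_subseq
    (fun n => hK' ⟨v (g n), by simpa using hv _ (hgS n), rfl⟩)
  have hc := hψy.cauchySeq
  rw [Metric.cauchySeq_iff'] at hc
  obtain ⟨N, hN⟩ := hc 1 one_pos
  have h1 := hN (N + 1) (Nat.le_succ N)
  have h2 : dist (b (g (ψ (N + 1)))) (b (g (ψ N))) < 1 := by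
    simpa [hRv _ (hgS _)] using h1
  have hne : g (ψ (N + 1)) ≠ g (ψ N) := fun h =>
    absurd (hψ.injective (hginj h)) (Nat.succ_ne_self N)
  rw [dist_eq_norm] at h2
  -- Distinct orthonormal vectors are at distance `√2`, so no subsequence of them is Cauchy.
  have h3 := @norm_sub_sq ℂ H _ _ _ (b (g (ψ (N + 1)))) (b (g (ψ N)))
  rw [hb.1, hb.1, hb.2 hne] at h3
  simp only [map_zero] at h3
  nlinarith [norm_nonneg (b (g (ψ (N + 1))) - b (g (ψ N)))]

variable {T : H →ₗ.[ℂ] H} {R : H →L[ℂ] H}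

section Eigenbasis

variable {ι : Type*} {b : HilbertBasis ι ℂ H} {f : ι → ℝ}

theorem IsNegOneResolvent.inner_eigenbasis (h : IsNegOneResolvent T R)
    (hb : ∀ i, (b i, (f i : ℂ) • b i) ∈ T.graph) {x y : H} (hxy : (x, y) ∈ T.graph) (i : ι) :
    ⟪b i, y⟫_ℂ = f i * ⟪b i, x⟫_ℂ := by
  rw [← h.inner_symm (hb i) hxy, inner_smul_left, Complex.conj_ofReal]

theorem IsNegOneResolvent.inner_eq_zero_of_mem_opEigenspace (h : IsNegOneResolvent T R)
    (hb : ∀ i, (b i, (f i : ℂ) • b i) ∈ T.graph) {z : ℂ} {x : H} (hx : x ∈ opEigenspace T z)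
    {i : ι} (hi : (f i : ℂ) ≠ z) : ⟪b i, x⟫_ℂ = 0 := by
  have := h.inner_eigenbasis hb (mem_opEigenspace_iff.1 hx) i
  rw [inner_smul_right] at this
  by_contra h0
  exact hi (mul_right_cancel₀ h0 this).symm

/-- Symmetry kills the coefficients of an eigenvector off the level set of `f`; finiteness of the
level set turns its expansion into a finite sum, so no closure of the span is needed. -/
theorem IsNegOneResolvent.opEigenspace_eq_span (h : IsNegOneResolvent T R)
    (hb : ∀ i, (b i, (f i : ℂ) • b i) ∈ T.graph) {z : ℂ}
    (hfin : {i | (f i : ℂ) = z}.Finite) :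
    opEigenspace T z = Submodule.span ℂ (b '' {i | (f i : ℂ) = z}) := by
  apply le_antisymm
  · intro x hx
    have hs := b.hasSum_repr x
    have h0 : ∀ i ∉ hfin.toFinset, b.repr x i • b i = 0 := by
      intro i hi
      rw [b.repr_apply_apply, h.inner_eq_zero_of_mem_opEigenspace hb hx (by simpa using hi),
        zero_smul]
    rw [hs.unique (hasSum_sum_of_ne_finset_zero h0)]
    refine Submodule.sum_mem _ fun i hi => Submodule.smul_mem _ _ (Submodule.subset_span ?_)
    exact ⟨i, by simpa using hi, rfl⟩
  · rw [Submodule.span_le]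
    rintro _ ⟨i, hi, rfl⟩
    have hi : (f i : ℂ) = z := hi
    change b i ∈ opEigenspace T z
    rw [mem_opEigenspace_iff, ← hi]
    exact hb i

theorem finite_setOf_ofReal_eq (hf : ∀ c, {i | f i ≤ c}.Finite) (z : ℂ) :
    {i | (f i : ℂ) = z}.Finite :=
  (hf z.re).subset fun i hi => by
    have hi : (f i : ℂ) = z := hi
    simp [← hi]

variable [CompleteSpace H]

/-- This is the Fredholm alternative for `R`. With `ν = (z + 1)⁻¹` one has `T - z = (z + 1) (ν - R)
(T + 1)`, and an eigenvector of `R` for `ν` would be one of `T` for `z`, orthogonal to the whole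
basis. -/
theorem IsNegOneResolvent.exists_eq_of_mem_opSpectrum (h : IsNegOneResolvent T R)
    (hc : IsCompactOperator R) (hb : ∀ i, (b i, (f i : ℂ) • b i) ∈ T.graph) {z : ℂ}
    (hz : z ∈ opSpectrum T) : ∃ i, (f i : ℂ) = z := by
  by_contra! hne
  apply hz
  have happ : ∀ {x y : H} (hxy : (x, y) ∈ T.graph), ∃ hx : x ∈ T.domain, T ⟨x, hx⟩ = y := by
    intro x y hxy
    obtain ⟨⟨x', hx'⟩, rfl, h2⟩ := T.mem_graph_iff.1 hxy
    exact ⟨hx', h2⟩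
  have hTR : ∀ x : T.domain, R ((x : H) + T x) = x := fun x =>
    (h.mem_graph_iff _ _).1 (T.mem_graph x)
  -- For `z = -1` the number `ν` is not available, but `R` itself is the inverse.
  rcases eq_or_ne z (-1) with rfl | hz1
  · refine ⟨R, fun y => ?_, fun x => ?_⟩
    · obtain ⟨hx, hy⟩ := happ (h.mem_graph y)
      exact ⟨hx, by rw [hy]; simp⟩
    · rw [neg_smul, one_smul, sub_neg_eq_add, add_comm, hTR]
  have hz1' : z + 1 ≠ 0 := fun h0 => hz1 (eq_neg_of_add_eq_zero_left h0)
  set ν : ℂ := (z + 1)⁻¹ with hν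
  have hν0 : ν ≠ 0 := inv_ne_zero hz1'
  have hνz : ν * (z + 1) = 1 := inv_mul_cancel₀ hz1'
  have hnot : ¬ Module.End.HasEigenvalue (R : H →ₗ[ℂ] H) ν := by
    intro hev
    obtain ⟨u, hu, hu0⟩ := hev.exists_hasEigenvector
    rw [Module.End.mem_eigenspace_iff] at hu
    have hu : R u = ν • u := hu
    have hmem : u ∈ opEigenspace T z := by
      rw [mem_opEigenspace_iff, h.mem_graph_iff, map_add, map_smul, hu, smul_smul, ← add_smul]
      have : ν + z * ν = 1 := by linear_combination hνz
      rw [this, one_smul]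
    apply hu0
    rw [← b.repr.map_eq_zero_iff]
    ext i
    rw [b.repr_apply_apply, h.inner_eq_zero_of_mem_opEigenspace hb hmem (hne i)]
    rfl
  have hunit := (hc.hasEigenvalue_or_mem_resolventSet hν0).resolve_left hnot
  rw [spectrum.mem_resolventSet_iff] at hunit
  obtain ⟨⟨W, U, hWU, hUW⟩, hW⟩ := hunit
  have hWapp : ∀ u, W u = ν • u - R u := fun u => by
    have : W = algebraMap ℂ (H →L[ℂ] H) ν - R := hW
    rw [this]; rfl
  have h1 : ∀ u, W (U u) = u := fun u => congrArg (fun F : H →L[ℂ] H => F u) hWU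
  have h2 : ∀ u, U (W u) = u := fun u => congrArg (fun F : H →L[ℂ] H => F u) hUW
  refine ⟨ν • (R ∘L U), fun y => ?_, fun x => ?_⟩
  · have hg := T.graph.smul_mem ν (h.mem_graph (U y))
    obtain ⟨hx, hy⟩ := happ hg
    refine ⟨hx, ?_⟩
    have e : ν • (U y - R (U y)) - z • ν • R (U y) = ν • U y - (ν * (z + 1)) • R (U y) := by
      module
    have e2 := h1 y
    rw [hWapp] at e2
    change T ⟨ν • R (U y), hx⟩ - z • ν • R (U y) = y
    rw [hy, e, hνz, one_smul, e2]
  · have hx := hTR x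
    have e : T x - z • (x : H) = (z + 1) • W ((x : H) + T x) := by
      rw [hWapp, hx, smul_sub, smul_smul, mul_comm, hνz]
      module
    change ν • R (U (T x - z • (x : H))) = x
    rw [e, map_smul, h2, map_smul, hx, smul_smul, hνz, one_smul]

end Eigenbasis

variable [CompleteSpace H]

open Module.End in
/-- A non-negative self-adjoint operator with compact resolvent has an orthonormal basis of
eigenvectors, and its eigenvalues accumulate only at infinity. -/
theorem IsNegOneResolvent.exists_eigenbasis (h : IsNegOneResolvent T R)
    (hc : IsCompactOperator R) :
    ∃ (ι : Type) (b : HilbertBasis ι ℂ H) (f : ι → ℝ),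
      (∀ i, (b i, (f i : ℂ) • b i) ∈ T.graph) ∧ ∀ c, {i | f i ≤ c}.Finite := by
  have hsym : (R : H →ₗ[ℂ] H).IsSymmetric := h.isSymmetric
  set E : ℂ → Submodule ℂ H := fun μ => eigenspace (R : H →ₗ[ℂ] H) μ with hE
  have hE0 : E 0 = ⊥ := by
    rw [Submodule.eq_bot_iff]
    intro x hx
    rw [hE, mem_eigenspace_iff, zero_smul] at hx
    exact h.eq_zero_of_apply_eq_zero hx
  have hfin : ∀ μ, FiniteDimensional ℂ (E μ) := by
    intro μ
    rcases eq_or_ne μ 0 with rfl | hμ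
    · rw [hE0]; infer_instance
    · exact ContinuousLinearMap.finite_dimensional_eigenspace hc μ hμ
  -- All complex `μ` are allowed: those that are not eigenvalues have `finrank` zero and contribute
  -- no index.
  set ι := Σ μ : ℂ, Fin (Module.finrank ℂ (E μ)) with hι
  set v : ι → H := fun i => (stdOrthonormalBasis ℂ (E i.1) i.2 : E i.1) with hv
  have hvo : Orthonormal ℂ v :=
    hsym.orthogonalFamily_eigenspaces.orthonormal_sigma_orthonormal
      (fun μ => (stdOrthonormalBasis ℂ (E μ)).orthonormal)
  have hvt : (Submodule.span ℂ (Set.range v))ᗮ = ⊥ := by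
    rw [eq_bot_iff, ← ContinuousLinearMap.orthogonalComplement_iSup_eigenspaces_eq_bot hc hsym]
    apply Submodule.orthogonal_le
    refine iSup_le fun μ x hx => ?_
    have hx' : (⟨x, hx⟩ : E μ) ∈ Submodule.span ℂ (Set.range (stdOrthonormalBasis ℂ (E μ))) := by
      rw [← OrthonormalBasis.coe_toBasis, Module.Basis.span_eq]; trivial
    have := Submodule.mem_map_of_mem (f := (E μ).subtype) hx'
    rw [Submodule.map_span] at this
    refine Submodule.span_mono ?_ this
    rintro _ ⟨_, ⟨j, rfl⟩, rfl⟩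
    exact ⟨⟨μ, j⟩, rfl⟩
  set b := HilbertBasis.mkOfOrthogonalEqBot hvo hvt with hb
  have hbv : ∀ i, b i = v i := fun i => by rw [hb, HilbertBasis.coe_mkOfOrthogonalEqBot]
  have hRv : ∀ i, R (v i) = i.1 • v i := fun i =>
    mem_eigenspace_iff.1 (stdOrthonormalBasis ℂ (E i.1) i.2 : E i.1).2
  have hinner : ∀ i, ⟪v i, R (v i)⟫_ℂ = i.1 := fun i => by
    rw [hRv, inner_smul_right, inner_self_eq_norm_sq_to_K, hvo.1]; simp
  have hv0 : ∀ i, v i ≠ 0 := fun i => hvo.ne_zero i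
  have hre : ∀ i : ι, ((i.1.re : ℝ) : ℂ) = i.1 := by
    intro i
    rw [← Complex.conj_eq_iff_re, ← hinner i, inner_conj_symm, h.isSymmetric]
  have hpos : ∀ i : ι, 0 < i.1.re := by
    intro i
    refine lt_of_le_of_ne ?_ fun h0 => hv0 i (h.eq_zero_of_apply_eq_zero ?_)
    · have := h.re_inner_nonneg (v i)
      rwa [h.isSymmetric, hinner] at this
    · rw [hRv, ← hre, ← h0]; simp
  have hne : ∀ i : ι, i.1 ≠ 0 := fun i h0 => by
    have := hpos i
    rw [h0] at this
    exact lt_irrefl _ this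
  have hf : ∀ i : ι, (((i.1.re)⁻¹ - 1 : ℝ) : ℂ) = i.1⁻¹ - 1 := fun i => by
    push_cast
    rw [hre]
  refine ⟨ι, b, fun i => (i.1.re)⁻¹ - 1, fun i => ?_, fun c => ?_⟩
  · rw [hbv, h.mem_graph_iff, hf, sub_smul, one_smul, add_sub_cancel, map_smul, hRv, smul_smul,
      inv_mul_cancel₀ (hne i), one_smul]
  -- An index with `μ⁻¹ - 1 ≤ c` has `v i = R (μ⁻¹ v i)` with a preimage of norm at most `c + 1`.
  · refine finite_of_orthonormal_image hc hvo (fun i => i.1⁻¹ • v i) (M := c + 1) ?_ ?_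
    · intro i hi
      have hi : (i.1.re)⁻¹ - 1 ≤ c := hi
      rw [norm_smul, hvo.1, mul_one, norm_inv, ← hre, Complex.norm_real, Real.norm_eq_abs,
        abs_of_pos (hpos i)]
      linarith
    · intro i _
      rw [map_smul, hRv, smul_smul, inv_mul_cancel₀ (hne i), one_smul]

/-- The spectrum consists of values of `f`, and since its sublevel sets are finite, only finitely
many of these lie near a given point, each with a finite-dimensional eigenspace. -/
theorem IsNegOneResolvent.hasPurelyDiscreteSpectrum (h : IsNegOneResolvent T R)
    (hc : IsCompactOperator R) : HasPurelyDiscreteSpectrum T := by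
  obtain ⟨ι, b, f, hb, hf⟩ := h.exists_eigenbasis hc
  rw [HasPurelyDiscreteSpectrum, essentialSpectrum, Set.sdiff_eq_empty]
  intro z hz
  have hfz := finite_setOf_ofReal_eq hf z
  have hspan := h.opEigenspace_eq_span hb hfz
  refine ⟨hz, ?_, ?_, ?_⟩
  · have hA : (((fun i => (f i : ℂ)) '' {i | f i ≤ z.re + 1}) \ {z}).Finite :=
      ((hf (z.re + 1)).image _).subset Set.sdiff_subset
    have h1 : ∀ᶠ w in 𝓝 z, w ∉ ((fun i => (f i : ℂ)) '' {i | f i ≤ z.re + 1}) \ {z} :=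
      hA.isClosed.isOpen_compl.mem_nhds (by simp)
    have h2 : ∀ᶠ w : ℂ in 𝓝 z, w.re < z.re + 1 :=
      (isOpen_lt Complex.continuous_re continuous_const).mem_nhds (by simp)
    filter_upwards [nhdsWithin_le_nhds h1, nhdsWithin_le_nhds h2, self_mem_nhdsWithin]
      with w hw1 hw2 hw3 hw4
    obtain ⟨i, rfl⟩ := h.exists_eq_of_mem_opSpectrum hc hb hw4
    refine hw1 ⟨⟨i, ?_, rfl⟩, hw3⟩
    simpa using hw2.le
  · obtain ⟨i, rfl⟩ := h.exists_eq_of_mem_opSpectrum hc hb hz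
    intro h0
    have : b i ∈ opEigenspace T (f i) := hb i
    rw [h0, Submodule.mem_bot] at this
    exact b.orthonormal.ne_zero i this
  · rw [hspan]
    exact FiniteDimensional.span_of_finite ℂ (hfz.image _)

end CompactResolvent

section DiscreteSpectrum

variable {H : Type*} [NormedAddCommGroup H] [InnerProductSpace ℂ H]
  {T : H →ₗ.[ℂ] H} {R : H →L[ℂ] H}

/-! ### Discrete spectrum implies compact resolvent -/

theorem IsNegOneResolvent.mem_opEigenspace (h : IsNegOneResolvent T R) {μ : ℝ} (hμ : μ ≠ 0)
    {u : H} (hu : R u = (μ : ℂ) • u) : u ∈ opEigenspace T ((μ⁻¹ - 1 : ℝ) : ℂ) := by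
  have hμ' : (μ : ℂ) ≠ 0 := Complex.ofReal_ne_zero.2 hμ
  rw [mem_opEigenspace_iff, h.mem_graph_iff, map_add, map_smul, hu, smul_smul, ← add_smul]
  have : (μ : ℂ) + ((μ⁻¹ - 1 : ℝ) : ℂ) * μ = 1 := by
    push_cast
    field_simp
    ring
  rw [this, one_smul]

variable [CompleteSpace H]

theorem IsNegOneResolvent.mem_opSpectrum (h : IsNegOneResolvent T R) {μ : ℝ} (hμ : μ ≠ 0)
    (hμR : μ ∈ spectrum ℝ R) : ((μ⁻¹ - 1 : ℝ) : ℂ) ∈ opSpectrum T := by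
  rintro ⟨Z, hZ, hZ'⟩
  have hμ' : (μ : ℂ) ≠ 0 := Complex.ofReal_ne_zero.2 hμ
  set z : ℂ := ((μ⁻¹ - 1 : ℝ) : ℂ) with hz
  have hz1 : z + 1 = (μ : ℂ)⁻¹ := by rw [hz]; push_cast; ring
  refine hμR ?_
  change IsUnit (algebraMap ℝ (H →L[ℂ] H) μ - R)
  have happ : ∀ u, (algebraMap ℝ (H →L[ℂ] H) μ - R) u = (μ : ℂ) • u - R u := fun u => rfl
  rw [ContinuousLinearMap.isUnit_iff_bijective]
  constructor
  · rw [injective_iff_map_eq_zero]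
    intro u hu
    rw [happ, sub_eq_zero] at hu
    have hm := h.mem_opEigenspace hμ hu.symm
    obtain ⟨⟨x, hx⟩, hxu, hTx⟩ := T.mem_graph_iff.1 (mem_opEigenspace_iff.1 hm)
    have := hZ' ⟨x, hx⟩
    simp only at hxu hTx this
    rw [hTx, hxu, sub_self, map_zero] at this
    exact this.symm
  · intro y
    obtain ⟨hd, hy⟩ := hZ y
    have h1 := (h.mem_graph_iff _ _).1 (T.mem_graph ⟨Z y, hd⟩)
    have h2 : Z y + T ⟨Z y, hd⟩ = y + (μ : ℂ)⁻¹ • Z y := by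
      rw [eq_add_of_sub_eq hy, ← hz1]
      module
    simp only [h2] at h1
    -- Here `(μ - R)⁻¹ = μ⁻¹ (T + 1) (T - z)⁻¹ = μ⁻¹ (1 + (z + 1) Z)` with `z + 1 = μ⁻¹`.
    refine ⟨(μ : ℂ)⁻¹ • (y + (μ : ℂ)⁻¹ • Z y), ?_⟩
    rw [map_smul, happ, h1, smul_add, smul_smul, mul_inv_cancel₀ hμ', one_smul,
      add_sub_cancel_right, smul_smul, inv_mul_cancel₀ hμ', one_smul]

/-- The points `μ > 0` of the spectrum of the resolvent are isolated eigenvalues of finite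
multiplicity, provided that the spectrum of the operator is purely discrete. -/
theorem IsNegOneResolvent.eventually_notMem_spectrum (h : IsNegOneResolvent T R)
    (hd : HasPurelyDiscreteSpectrum T) {μ : ℝ} (hμ : 0 < μ) (hμR : μ ∈ spectrum ℝ R) :
    (∀ᶠ t in 𝓝[≠] μ, t ∉ spectrum ℝ R) ∧
      FiniteDimensional ℂ (opEigenspace T ((μ⁻¹ - 1 : ℝ) : ℂ)) := by
  rw [HasPurelyDiscreteSpectrum, essentialSpectrum, Set.sdiff_eq_empty] at hd
  obtain ⟨-, h2, -, h4⟩ := hd (h.mem_opSpectrum hμ.ne' hμR)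
  refine ⟨?_, h4⟩
  have hcont : Tendsto (fun t : ℝ => ((t⁻¹ - 1 : ℝ) : ℂ)) (𝓝[≠] μ)
      (𝓝[≠] ((μ⁻¹ - 1 : ℝ) : ℂ)) := by
    refine tendsto_nhdsWithin_iff.2 ⟨?_, ?_⟩
    · refine Tendsto.mono_left ?_ nhdsWithin_le_nhds
      have : ContinuousAt (fun t : ℝ => t⁻¹ - 1) μ := by
        have := hμ.ne'
        fun_prop (disch := assumption)
      exact (Complex.continuous_ofReal.tendsto _).comp this
    · filter_upwards [self_mem_nhdsWithin] with t ht h0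
      apply ht
      have h0 : ((t⁻¹ - 1 : ℝ) : ℂ) = ((μ⁻¹ - 1 : ℝ) : ℂ) := h0
      have := Complex.ofReal_injective h0
      exact inv_injective (by linarith)
  have hpos : ∀ᶠ t in 𝓝[≠] μ, t ≠ 0 :=
    nhdsWithin_le_nhds (isOpen_ne.mem_nhds hμ.ne')
  filter_upwards [hcont.eventually h2, hpos] with t ht ht0 htR
  exact ht (h.mem_opSpectrum ht0 htR)

/-- Above any `ε > 0` the spectrum of `R` is a finite set of isolated eigenvalues of finite
multiplicity. Removing their spectral projections leaves an operator of norm at most `ε`, so `R` is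
a norm limit of finite-rank operators. -/
theorem IsNegOneResolvent.isCompactOperator (h : IsNegOneResolvent T R)
    (hd : HasPurelyDiscreteSpectrum T) : IsCompactOperator R := by
  have hsa : IsSelfAdjoint R := IsSelfAdjoint.of_nonneg h.nonneg
  have hfin : ∀ ε : ℝ, 0 < ε → (spectrum ℝ R ∩ Set.Ici ε).Finite := by
    intro ε hε
    by_contra hinf
    have hK : IsCompact (spectrum ℝ R ∩ Set.Ici ε) :=
      (spectrum.isCompact R).inter_right isClosed_Ici
    obtain ⟨μ, hμ, hacc⟩ := Set.Infinite.exists_accPt_of_subset_isCompact hinf hK subset_rfl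
    have h1 := (h.eventually_notMem_spectrum hd (hε.trans_le hμ.2) hμ.1).1
    rw [accPt_iff_frequently_nhdsNE] at hacc
    exact hacc (h1.mono fun t ht ht' => ht ht'.1)
  -- The indicator of an isolated point is continuous on the spectrum, so the continuous functional
  -- calculus already provides the spectral projection.
  have hcont : ∀ μ : ℝ, 0 < μ → ContinuousOn (fun t => if t = μ then (1 : ℝ) else 0)
      (spectrum ℝ R) := by
    intro μ hμ t ht
    by_cases htμ : t = μ
    · subst htμ
      have h1 := (h.eventually_notMem_spectrum hd hμ ht).1
      have h2 : ∀ᶠ s in 𝓝[spectrum ℝ R] t, s = t := by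
        rw [eventually_nhdsWithin_iff] at h1 ⊢
        filter_upwards [h1] with s hs hs'
        by_contra hne
        exact hs hne hs'
      refine Tendsto.congr' ?_ tendsto_const_nhds
      filter_upwards [h2] with s hs
      rw [hs]
    · refine ContinuousAt.continuousWithinAt ?_
      have : ∀ᶠ s in 𝓝 t, s ≠ μ := isOpen_ne.mem_nhds htμ
      refine Tendsto.congr' ?_ tendsto_const_nhds
      filter_upwards [this] with s hs
      simp [hs, htμ]
  have hproj : ∀ μ : ℝ, 0 < μ → μ ∈ spectrum ℝ R →
      IsCompactOperator (cfc (fun t => if t = μ then (1 : ℝ) else 0) R : H →L[ℂ] H) := by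
    intro μ hμ hμR
    set P := cfc (fun t => if t = μ then (1 : ℝ) else 0) R with hP
    have hRP : ∀ u, R (P u) = (μ : ℂ) • P u := by
      intro u
      have e1 : R * P = μ • P := by
        conv_lhs => rw [← cfc_id' ℝ R hsa]
        rw [hP, ← cfc_mul (fun t : ℝ => t) _ R continuousOn_id (hcont μ hμ),
          ← cfc_smul μ _ R (hcont μ hμ)]
        refine cfc_congr fun t _ => ?_
        by_cases ht : t = μ <;> simp [ht]
      have := congrArg (fun F : H →L[ℂ] H => F u) e1
      exact this
    have := (h.eventually_notMem_spectrum hd hμ hμR).2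
    set W := opEigenspace T ((μ⁻¹ - 1 : ℝ) : ℂ)
    -- The projection factors through the finite-dimensional eigenspace of `T`, hence is compact.
    have hPW : ∀ u, P u ∈ W := fun u => h.mem_opEigenspace hμ.ne' (hRP u)
    have h1 : IsCompactOperator (P.codRestrict W hPW) :=
      isCompactOperator_of_locallyCompactSpace_dom (P.codRestrict W hPW)
    exact h1.clm_comp W.subtypeL
  have happrox : ∀ ε : ℝ, 0 < ε → ∃ F : H →L[ℂ] H, IsCompactOperator F ∧ ‖R - F‖ ≤ ε := by
    intro ε hε
    set S := (hfin ε hε).toFinset with hS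
    have hSpos : ∀ μ ∈ S, 0 < μ ∧ μ ∈ spectrum ℝ R := fun μ hμ => by
      rw [hS, Set.Finite.mem_toFinset] at hμ
      exact ⟨hε.trans_le hμ.2, hμ.1⟩
    set g : ℝ → ℝ → ℝ := fun μ t => μ • (if t = μ then (1 : ℝ) else 0) with hg
    have hgc : ∀ μ ∈ S, ContinuousOn (g μ) (spectrum ℝ R) := fun μ hμ =>
      (hcont μ (hSpos μ hμ).1).const_smul μ
    have hgsum : ContinuousOn (fun t => ∑ μ ∈ S, g μ t) (spectrum ℝ R) :=
      continuousOn_finsetSum _ hgc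
    refine ⟨∑ μ ∈ S, cfc (g μ) R, ?_, ?_⟩
    · have : (∑ μ ∈ S, cfc (g μ) R) ∈ compactOperator (RingHom.id ℂ) H H := by
        refine Submodule.sum_mem _ fun μ hμ => ?_
        have e : cfc (g μ) R = (μ : ℂ) • cfc (fun t => if t = μ then (1 : ℝ) else 0) R := by
          rw [hg]
          simp only
          rw [cfc_smul μ _ R (hcont μ (hSpos μ hμ).1)]
          rfl
        rw [e]
        exact Submodule.smul_mem _ _ (hproj μ (hSpos μ hμ).1 (hSpos μ hμ).2)
      exact this
    · have e : R - ∑ μ ∈ S, cfc (g μ) R = cfc (fun t => t - ∑ μ ∈ S, g μ t) R := by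
        rw [cfc_sub (fun t : ℝ => t) _ R continuousOn_id hgsum, cfc_id' ℝ R hsa,
          ← cfc_sum g R S hgc]
        congr 2
        funext t
        rw [Finset.sum_apply]
      rw [e]
      refine norm_cfc_le hε.le fun t ht => ?_
      have ht0 : 0 ≤ t := spectrum_nonneg_of_nonneg h.nonneg ht
      by_cases htS : t ∈ S
      · have : ∑ μ ∈ S, g μ t = t := by
          rw [Finset.sum_eq_single t]
          · simp [hg]
          · intro μ _ hne
            simp [hg, hne.symm]
          · intro h0; exact absurd htS h0
        rw [this]; simpa using hε.le
      · have : ∑ μ ∈ S, g μ t = 0 := by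
          refine Finset.sum_eq_zero fun μ hμ => ?_
          have : t ≠ μ := fun h0 => htS (h0 ▸ hμ)
          simp [hg, this]
        rw [this, sub_zero, Real.norm_eq_abs, abs_of_nonneg ht0]
        by_contra hlt
        exact htS (by rw [hS, Set.Finite.mem_toFinset]; exact ⟨ht, (not_le.1 hlt).le⟩)
  choose F hF hFR using fun n : ℕ => happrox (1 / ((n : ℝ) + 1)) (by positivity)
  refine isCompactOperator_of_tendsto (F := F) (l := atTop) ?_ (Eventually.of_forall hF)
  rw [tendsto_iff_norm_sub_tendsto_zero]
  refine squeeze_zero (fun n => norm_nonneg _) (fun n => ?_)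
    tendsto_one_div_add_atTop_nhds_zero_nat
  rw [norm_sub_rev]
  exact hFR n

/-! ### Enumerating eigenvalues -/

/-- Ordering the indices by the value of `f`, with ties broken by an injection into `ℕ`, gives an
infinite linear order with finite initial segments, which must be order isomorphic to `ℕ`. -/
theorem exists_equiv_nat_monotone {ι : Type*} [Infinite ι] {f : ι → ℝ}
    (hf : ∀ c, {i | f i ≤ c}.Finite) : ∃ e : ℕ ≃ ι, Monotone (f ∘ e) := by
  have hcount : Countable ι := by
    rw [← Set.countable_univ_iff]
    have : (Set.univ : Set ι) = ⋃ n : ℕ, {i | f i ≤ n} := by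
      ext i
      simpa using exists_nat_ge (f i)
    rw [this]
    exact Set.countable_iUnion fun n => (hf n).countable
  obtain ⟨enc, henc⟩ := hcount.exists_injective_nat
  set key : ι → ℝ ×ₗ ℕ := fun i => toLex (f i, enc i) with hkey
  have hkinj : Function.Injective key := fun i j hij => henc (Prod.ext_iff.1 (toLex.injective hij)).2
  let : LinearOrder ι := LinearOrder.lift' key hkinj
  have hle : ∀ {i j : ι}, i ≤ j → f i ≤ f j := by
    intro i j hij
    have hij : key i ≤ key j := hij
    rcases (Prod.Lex.toLex_le_toLex).1 hij with h1 | h1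
    · exact h1.le
    · exact h1.1.le
  have hIic : ∀ j : ι, (Set.Iic j).Finite := fun j => (hf (f j)).subset fun i hi => hle hi
  let : LocallyFiniteOrder ι :=
    LocallyFiniteOrder.ofFiniteIcc fun a b => (hIic b).subset fun i hi => hi.2
  let : SuccOrder ι := LinearLocallyFiniteOrder.succOrder ι
  let : PredOrder ι := LinearLocallyFiniteOrder.predOrder ι
  obtain ⟨i₀⟩ : Nonempty ι := inferInstance
  obtain ⟨m, hm, hmin⟩ := (hIic i₀).exists_minimal ⟨i₀, Set.mem_Iic.2 le_rfl⟩
  let : OrderBot ι :=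
    { bot := m
      bot_le := fun i => by
        rcases le_total i i₀ with hi | hi
        · rcases le_total m i with h1 | h1
          · exact h1
          · exact hmin hi h1
        · exact hm.trans hi }
  have : NoMaxOrder ι := ⟨fun a => by
    by_contra! hmax
    exact Set.infinite_univ ((hIic a).subset fun i _ => hmax i)⟩
  exact ⟨(orderIsoNatOfLinearSuccPredArch (ι := ι)).symm.toEquiv, fun m n hmn =>
    hle ((orderIsoNatOfLinearSuccPredArch (ι := ι)).symm.monotone hmn)⟩

theorem IsNegOneResolvent.isEigenvalueSequence (h : IsNegOneResolvent T R)
    (hc : IsCompactOperator R) {ι : Type*} {b : HilbertBasis ι ℂ H} {f : ι → ℝ}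
    (hb : ∀ i, (b i, (f i : ℂ) • b i) ∈ T.graph) (hf : ∀ c, {i | f i ≤ c}.Finite)
    (e : ℕ ≃ ι) (he : Monotone (f ∘ e)) : IsEigenvalueSequence T (f ∘ e) := by
  have hess : essentialSpectrum T = ∅ := h.hasPurelyDiscreteSpectrum hc
  refine ⟨he, fun n s hs => ?_, fun t _ => ?_⟩
  · rw [hess] at hs
    exact hs.elim
  · have hfin := finite_setOf_ofReal_eq hf (t : ℂ)
    have hset : {i | (f i : ℂ) = (t : ℂ)} = e '' {n | (f ∘ e) n = t} := by
      ext i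
      simp only [Complex.ofReal_inj, Set.mem_ofPred_eq, Set.mem_image, Function.comp_apply]
      exact ⟨fun hi => ⟨e.symm i, by simpa using hi, by simp⟩, by rintro ⟨n, hn, rfl⟩; exact hn⟩
    rw [h.opEigenspace_eq_span hb hfin, rank_span_set, hset, Set.toENat_cardinalMk,
      (b.orthonormal.linearIndependent.injective).encard_image, e.injective.encard_image]
    exact (b.orthonormal.linearIndependent.linearIndepOn _).id_image

end DiscreteSpectrum

section CheegerInequality

variable {V : Type*}

/-! ### The Cheeger inequality for weighted graphs -/

/-- An isoperimetric inequality for the subsets of `s` extends to non-negative functions on `s`, by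
the layer cake decomposition. -/
theorem sum_mul_min_le {w : V → V → ℝ} {g : V → ℝ} {γ : ℝ} (s : Finset V)
    (hw : ∀ W ⊆ s, ∑ x ∈ W, ∑ y ∈ W, w x y ≤ γ * ∑ x ∈ W, g x)
    (h : V → ℝ) (hh : ∀ x ∈ s, 0 ≤ h x) :
    ∑ x ∈ s, ∑ y ∈ s, w x y * min (h x) (h y) ≤ γ * ∑ x ∈ s, g x * h x := by
  classical
  induction s using Finset.strongInduction generalizing h with
  | H s ih =>
  rcases s.eq_empty_or_nonempty with rfl | hs
  · simp
  obtain ⟨x₀, hx₀, hmin⟩ := s.exists_min_image h hs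
  -- Subtracting the minimum `m` makes `h` vanish at `x₀`, so the induction hypothesis applies to
  -- `s.erase x₀`; the removed layer is `m` times the hypothesis for `W = s`.
  set m := h x₀ with hm
  have hm0 : 0 ≤ m := hh x₀ hx₀
  set t := s.erase x₀ with ht
  have hts : t ⊂ s := Finset.erase_ssubset hx₀
  have key := ih t hts (fun W hW => hw W (hW.trans hts.subset)) (fun x => h x - m)
    (fun x hx => sub_nonneg.2 (hmin x (hts.subset hx)))
  have hinner : ∀ x ∈ s, ∑ y ∈ t, w x y * min (h x - m) (h y - m) =
      ∑ y ∈ s, w x y * min (h x - m) (h y - m) := by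
    intro x hx
    refine Finset.sum_erase s ?_
    rw [← hm, sub_self, min_eq_right (sub_nonneg.2 (hmin x hx)), mul_zero]
  have h1 : ∑ x ∈ t, ∑ y ∈ t, w x y * min (h x - m) (h y - m) =
      ∑ x ∈ s, ∑ y ∈ s, w x y * min (h x - m) (h y - m) := by
    rw [Finset.sum_congr rfl fun x hx => hinner x (hts.subset hx)]
    refine Finset.sum_erase s (Finset.sum_eq_zero fun y hy => ?_)
    rw [← hm, sub_self, min_eq_left (sub_nonneg.2 (hmin y hy)), mul_zero]
  have h2 : ∑ x ∈ t, g x * (h x - m) = ∑ x ∈ s, g x * (h x - m) := by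
    refine Finset.sum_erase s ?_
    rw [← hm, sub_self, mul_zero]
  rw [h1, h2] at key
  have h3 : ∑ x ∈ s, ∑ y ∈ s, w x y * min (h x) (h y) =
      ∑ x ∈ s, ∑ y ∈ s, w x y * min (h x - m) (h y - m) + m * ∑ x ∈ s, ∑ y ∈ s, w x y := by
    simp only [Finset.mul_sum, ← Finset.sum_add_distrib]
    refine Finset.sum_congr rfl fun x _ => Finset.sum_congr rfl fun y _ => ?_
    rw [min_sub_sub_right]
    ring
  have h4 : ∑ x ∈ s, g x * h x = ∑ x ∈ s, g x * (h x - m) + m * ∑ x ∈ s, g x := by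
    simp only [Finset.mul_sum, ← Finset.sum_add_distrib]
    refine Finset.sum_congr rfl fun x _ => ?_
    ring
  rw [h3, h4, mul_add]
  have h5 := mul_le_mul_of_nonneg_left (hw s subset_rfl) hm0
  linarith

/-- Cheeger's inequality: an isoperimetric inequality for the subsets of `s` bounds the quadratic
form of the adjacency operator on `s`. -/
theorem sum_mul_mul_le_sqrt {w : V → V → ℝ} {g : V → ℝ} {β : ℝ} (s : Finset V) (hβ : 0 ≤ β)
    (hw0 : ∀ x y, 0 ≤ w x y) (hwsymm : ∀ x y, w x y = w y x)
    (hdeg : ∀ x ∈ s, ∑ y ∈ s, w x y ≤ g x)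
    (hw : ∀ W ⊆ s, ∑ x ∈ W, ∑ y ∈ W, w x y ≤ (1 - β) * ∑ x ∈ W, g x)
    (f : V → ℝ) (hf : ∀ x, 0 ≤ f x) :
    ∑ x ∈ s, ∑ y ∈ s, w x y * (f x * f y) ≤ √(1 - β ^ 2) * ∑ x ∈ s, g x * f x ^ 2 := by
  set D := ∑ x ∈ s, g x * f x ^ 2 with hD
  set a := ∑ x ∈ s, ∑ y ∈ s, w x y * (f x * f y) with ha
  -- The part of `g x` not used by edges inside `s`. It acts as an edge from `x` to an extra vertex
  -- where `f` is zero.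
  set c : V → ℝ := fun x => g x - ∑ y ∈ s, w x y with hc
  set k := ∑ x ∈ s, c x * f x ^ 2 with hk
  set P := ∑ p ∈ s ×ˢ s, w p.1 p.2 * |f p.1 ^ 2 - f p.2 ^ 2| with hP
  set M := ∑ p ∈ s ×ˢ s, w p.1 p.2 * (f p.1 - f p.2) ^ 2 with hM
  set N := ∑ p ∈ s ×ˢ s, w p.1 p.2 * (f p.1 + f p.2) ^ 2 with hN
  have hk0 : 0 ≤ k := Finset.sum_nonneg fun x hx =>
    mul_nonneg (sub_nonneg.2 (hdeg x hx)) (sq_nonneg _)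
  have hM0 : 0 ≤ M := Finset.sum_nonneg fun p _ => mul_nonneg (hw0 _ _) (sq_nonneg _)
  have hN0 : 0 ≤ N := Finset.sum_nonneg fun p _ => mul_nonneg (hw0 _ _) (sq_nonneg _)
  have hP0 : 0 ≤ P := Finset.sum_nonneg fun p _ => mul_nonneg (hw0 _ _) (abs_nonneg _)
  have hg0 : ∀ x ∈ s, 0 ≤ g x := fun x hx =>
    (Finset.sum_nonneg fun y _ => hw0 x y).trans (hdeg x hx)
  have hD0 : 0 ≤ D := Finset.sum_nonneg fun x hx => mul_nonneg (hg0 x hx) (sq_nonneg _)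
  have ha0 : 0 ≤ a := Finset.sum_nonneg fun x _ => Finset.sum_nonneg fun y _ =>
    mul_nonneg (hw0 _ _) (mul_nonneg (hf x) (hf y))
  have hleft : ∑ p ∈ s ×ˢ s, w p.1 p.2 * f p.1 ^ 2 = D - k := by
    rw [Finset.sum_product, hD, hk, ← Finset.sum_sub_distrib]
    refine Finset.sum_congr rfl fun x _ => ?_
    simp only [hc, ← Finset.sum_mul]
    ring
  have hright : ∑ p ∈ s ×ˢ s, w p.1 p.2 * f p.2 ^ 2 = D - k := by
    rw [← hleft, Finset.sum_product_right, Finset.sum_product]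
    refine Finset.sum_congr rfl fun x _ => Finset.sum_congr rfl fun y _ => ?_
    rw [hwsymm]
  have ha' : a = ∑ p ∈ s ×ˢ s, w p.1 p.2 * (f p.1 * f p.2) := by
    rw [Finset.sum_product]
  have hMeq : M = 2 * (D - k) - 2 * a := by
    have : M = ∑ p ∈ s ×ˢ s, w p.1 p.2 * f p.1 ^ 2 + ∑ p ∈ s ×ˢ s, w p.1 p.2 * f p.2 ^ 2
        - 2 * ∑ p ∈ s ×ˢ s, w p.1 p.2 * (f p.1 * f p.2) := by
      rw [hM, Finset.mul_sum, ← Finset.sum_add_distrib, ← Finset.sum_sub_distrib]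
      exact Finset.sum_congr rfl fun p _ => by ring
    rw [this, hleft, hright, ha']; ring
  have hNeq : N = 2 * (D - k) + 2 * a := by
    have : N = ∑ p ∈ s ×ˢ s, w p.1 p.2 * f p.1 ^ 2 + ∑ p ∈ s ×ˢ s, w p.1 p.2 * f p.2 ^ 2
        + 2 * ∑ p ∈ s ×ˢ s, w p.1 p.2 * (f p.1 * f p.2) := by
      rw [hN, Finset.mul_sum, ← Finset.sum_add_distrib, ← Finset.sum_add_distrib]
      exact Finset.sum_congr rfl fun p _ => by ring
    rw [this, hleft, hright, ha']; ring
  -- The co-area estimate: apply the layer cake inequality to `f²`, using `2 min (a, b) = a + b - |a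
  -- - b|`.
  have hPle : 2 * (β * D) ≤ 2 * k + P := by
    have h1 := sum_mul_min_le s hw (fun x => f x ^ 2) fun x _ => sq_nonneg _
    have h2 : P = ∑ p ∈ s ×ˢ s, w p.1 p.2 * f p.1 ^ 2 + ∑ p ∈ s ×ˢ s, w p.1 p.2 * f p.2 ^ 2
        - 2 * ∑ p ∈ s ×ˢ s, w p.1 p.2 * min (f p.1 ^ 2) (f p.2 ^ 2) := by
      rw [hP, Finset.mul_sum, ← Finset.sum_add_distrib, ← Finset.sum_sub_distrib]
      refine Finset.sum_congr rfl fun p _ => ?_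
      rcases le_total (f p.1 ^ 2) (f p.2 ^ 2) with h3 | h3
      · rw [min_eq_left h3, abs_of_nonpos (sub_nonpos.2 h3)]; ring
      · rw [min_eq_right h3, abs_of_nonneg (sub_nonneg.2 h3)]; ring
    rw [Finset.sum_product (f := fun p => w p.1 p.2 * min (f p.1 ^ 2) (f p.2 ^ 2)), hleft,
      hright] at h2
    linarith
  have hCS : P ^ 2 ≤ M * N := by
    refine Finset.sum_sq_le_sum_mul_sum_of_sq_le_mul _
      (fun p _ => mul_nonneg (hw0 _ _) (sq_nonneg _))
      (fun p _ => mul_nonneg (hw0 _ _) (sq_nonneg _)) fun p _ => le_of_eq ?_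
    rw [mul_pow, sq_abs]
    ring
  -- Cauchy–Schwarz including the extra vertex. As `2k + M = 2(D - a)` and `2k + N = 2(D + a)`, the
  -- right side is `4(D² - a²)`, which yields `a² ≤ (1 - β²) D²`.
  have hCS2 : (2 * k + P) ^ 2 ≤ (2 * k + M) * (2 * k + N) := by
    have h1 : 2 * P ≤ M + N := by
      refine abs_le_of_sq_le_sq' ?_ (by positivity) |>.2
      nlinarith [sq_nonneg (M - N)]
    nlinarith
  have hfin : a ^ 2 ≤ (1 - β ^ 2) * D ^ 2 := by
    have h1 : (2 * (β * D)) ^ 2 ≤ (2 * k + P) ^ 2 := by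
      have : 0 ≤ 2 * (β * D) := by positivity
      gcongr
    rw [hMeq, hNeq] at hCS2
    nlinarith
  calc a ≤ √((1 - β ^ 2) * D ^ 2) := Real.le_sqrt_of_sq_le hfin
    _ = √(1 - β ^ 2) * D := by rw [Real.sqrt_mul' _ (sq_nonneg D), Real.sqrt_sq hD0]

end CheegerInequality

/-! ### Adjacency weights, edge boundaries and Cheeger quotients -/

section Graph

variable {V : Type*} (G : SimpleGraph V)

open scoped Classical in
/-- The adjacency matrix with real entries. -/
noncomputable def adjWeight (x y : V) : ℝ := if G.Adj x y then 1 else 0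

theorem adjWeight_nonneg (x y : V) : 0 ≤ adjWeight G x y := by
  unfold adjWeight; split_ifs <;> norm_num

theorem adjWeight_comm (x y : V) : adjWeight G x y = adjWeight G y x := by
  unfold adjWeight
  by_cases h : G.Adj x y
  · rw [if_pos h, if_pos h.symm]
  · rw [if_neg h, if_neg fun h' => h h'.symm]

variable [G.LocallyFinite] {q : V → ℝ}

open scoped Classical in
theorem sum_adjWeight (s : Finset V) (x : V) :
    ∑ y ∈ s, adjWeight G x y = ((s ∩ G.neighborFinset x).card : ℝ) := by
  unfold adjWeight
  rw [Finset.sum_boole]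
  congr 2
  ext y
  simp

theorem sum_adjWeight_le_degree (s : Finset V) (x : V) :
    ∑ y ∈ s, adjWeight G x y ≤ G.degree x := by
  classical
  rw [sum_adjWeight, ← G.card_neighborFinset_eq_degree]
  exact_mod_cast Finset.card_le_card Finset.inter_subset_right

theorem degPot_nonneg (hq : ∀ x, 0 ≤ q x) (x : V) : 0 ≤ degPot G q x :=
  add_nonneg (Nat.cast_nonneg _) (hq x)

theorem sum_adjWeight_le_degPot (hq : ∀ x, 0 ≤ q x) (s : Finset V) (x : V) :
    ∑ y ∈ s, adjWeight G x y ≤ degPot G q x :=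
  (sum_adjWeight_le_degree G s x).trans (le_add_of_nonneg_right (hq x))

theorem ncard_edgeBoundary (W : Finset V) : ((edgeBoundary G W).ncard : ℝ) =
    ∑ x ∈ W, (G.degree x : ℝ) - ∑ x ∈ W, ∑ y ∈ W, adjWeight G x y := by
  classical
  have h1 : edgeBoundary G W =
      (((W.sigma fun x => G.neighborFinset x \ W).map
        (Equiv.sigmaEquivProd V V).toEmbedding : Finset (V × V)) : Set (V × V)) := by
    ext ⟨x, y⟩
    simp [edgeBoundary, and_comm]
  rw [h1, Set.ncard_coe_finset, Finset.card_map, Finset.card_sigma, ← Finset.sum_sub_distrib]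
  push_cast
  refine Finset.sum_congr rfl fun x _ => ?_
  rw [sum_adjWeight, eq_sub_iff_add_eq, ← G.card_neighborFinset_eq_degree, Finset.inter_comm]
  exact_mod_cast Finset.card_sdiff_add_card_inter _ _

theorem cheegerQuotient_nonneg (hq : ∀ x, 0 ≤ q x) (W : Finset V) : 0 ≤ cheegerQuotient G q W :=
  div_nonneg (add_nonneg (Nat.cast_nonneg _) (Finset.sum_nonneg fun x _ => hq x))
    (Finset.sum_nonneg fun x _ => degPot_nonneg G hq x)

theorem cheegerQuotient_le_one (hq : ∀ x, 0 ≤ q x) (W : Finset V) : cheegerQuotient G q W ≤ 1 := by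
  refine div_le_one_of_le₀ ?_ (Finset.sum_nonneg fun x _ => degPot_nonneg G hq x)
  rw [ncard_edgeBoundary]
  unfold degPot
  rw [Finset.sum_add_distrib]
  have : 0 ≤ ∑ x ∈ W, ∑ y ∈ W, adjWeight G x y :=
    Finset.sum_nonneg fun x _ => Finset.sum_nonneg fun y _ => adjWeight_nonneg G x y
  linarith

theorem cheegerConst_nonneg (hq : ∀ x, 0 ≤ q x) (U : Set V) : 0 ≤ cheegerConst G q U := by
  refine Real.sInf_nonneg ?_
  rintro _ ⟨W, -, -, rfl⟩
  exact cheegerQuotient_nonneg G hq W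

theorem cheegerConst_le_cheegerQuotient (hq : ∀ x, 0 ≤ q x) {U : Set V} {W : Finset V}
    (hW : W.Nonempty) (hWU : (W : Set V) ⊆ U) : cheegerConst G q U ≤ cheegerQuotient G q W := by
  refine csInf_le ⟨0, ?_⟩ ⟨W, hW, hWU, rfl⟩
  rintro _ ⟨W, -, -, rfl⟩
  exact cheegerQuotient_nonneg G hq W

theorem cheegerConst_le_one (hq : ∀ x, 0 ≤ q x) (U : Set V) : cheegerConst G q U ≤ 1 := by
  rcases U.eq_empty_or_nonempty with rfl | ⟨x, hx⟩
  · have : {r | ∃ W : Finset V, W.Nonempty ∧ (W : Set V) ⊆ ∅ ∧ r = cheegerQuotient G q W} = ∅ := by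
      rw [Set.eq_empty_iff_forall_notMem]
      rintro _ ⟨W, hW, hW', -⟩
      obtain ⟨y, hy⟩ := hW
      exact hW' hy
    rw [cheegerConst, this, Real.sInf_empty]
    exact zero_le_one
  · exact (cheegerConst_le_cheegerQuotient G hq (Finset.singleton_nonempty x)
      (by simpa using hx)).trans (cheegerQuotient_le_one G hq _)

/-- The isoperimetric inequality rewritten through `|∂W| = deg(W) - ∑ adjWeight`, the shape required
by `sum_mul_mul_le_sqrt`. If the denominator of the quotient vanishes, `W` has no internal edges and
both sides are zero. -/
theorem sum_sum_adjWeight_le (hq : ∀ x, 0 ≤ q x) {U : Set V} {W : Finset V}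
    (hWU : (W : Set V) ⊆ U) : ∑ x ∈ W, ∑ y ∈ W, adjWeight G x y ≤
      (1 - cheegerConst G q U) * ∑ x ∈ W, degPot G q x := by
  rcases W.eq_empty_or_nonempty with rfl | hW
  · simp
  have h1 := cheegerConst_le_cheegerQuotient G hq hW hWU
  have h2 : 0 ≤ ∑ x ∈ W, degPot G q x := Finset.sum_nonneg fun x _ => degPot_nonneg G hq x
  have h3 : ∑ x ∈ W, degPot G q x = ∑ x ∈ W, (G.degree x : ℝ) + ∑ x ∈ W, q x :=
    Finset.sum_add_distrib
  have h4 := ncard_edgeBoundary G W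
  have h0 : 0 ≤ ∑ x ∈ W, ∑ y ∈ W, adjWeight G x y :=
    Finset.sum_nonneg fun x _ => Finset.sum_nonneg fun y _ => adjWeight_nonneg G x y
  rcases h2.eq_or_lt with h5 | h5
  · have h6 : (0 : ℝ) ≤ (edgeBoundary G W).ncard := Nat.cast_nonneg _
    have h7 : 0 ≤ ∑ x ∈ W, q x := Finset.sum_nonneg fun x _ => hq x
    rw [← h5, mul_zero]
    linarith
  · rw [cheegerQuotient, le_div_iff₀ h5, h4] at h1
    linarith

/-- The adjacency form is bounded by the form of `deg + q`, relative to the Cheeger constant of the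
complement of a finite set, up to a bounded term. -/
theorem sum_adjWeight_mul_le (hq : ∀ x, 0 ≤ q x) (K s : Finset V) (f : V → ℝ)
    (hf : ∀ x, 0 ≤ f x) :
    ∑ x ∈ s, ∑ y ∈ s, adjWeight G x y * (f x * f y) ≤
      √(1 - cheegerConst G q ((K : Set V)ᶜ) ^ 2) * ∑ x ∈ s, degPot G q x * f x ^ 2 +
        2 * (∑ x ∈ K, (G.degree x : ℝ)) * ∑ x ∈ s, f x ^ 2 := by
  classical
  set β := cheegerConst G q ((K : Set V)ᶜ)
  set t := s.filter (· ∉ K) with ht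
  set t' := s.filter (· ∈ K) with ht'
  have hsplit : ∀ F : V → ℝ, ∑ x ∈ s, F x = ∑ x ∈ t', F x + ∑ x ∈ t, F x := fun F =>
    (Finset.sum_filter_add_sum_filter_not s (· ∈ K) F).symm
  have hnn : ∀ x y, 0 ≤ adjWeight G x y * (f x * f y) := fun x y =>
    mul_nonneg (adjWeight_nonneg G x y) (mul_nonneg (hf x) (hf y))
  have hfx : ∀ x ∈ s, f x ^ 2 ≤ ∑ x ∈ s, f x ^ 2 := fun x hx =>
    Finset.single_le_sum (f := fun x => f x ^ 2) (fun y _ => sq_nonneg _) hx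
  set n2 := ∑ x ∈ s, f x ^ 2 with hn2
  have hn0 : 0 ≤ n2 := Finset.sum_nonneg fun x _ => sq_nonneg _
  have hprod : ∀ x ∈ s, ∀ y ∈ s, f x * f y ≤ n2 := fun x hx y hy => by
    nlinarith [hfx x hx, hfx y hy, sq_nonneg (f x - f y)]
  -- Pairs meeting `K` are bounded crudely by `f x * f y ≤ ‖f‖²` and the degrees on `K`. They are
  -- counted once for `x ∈ K` and once for `y ∈ K`, whence the factor `2`.
  have hcross : ∑ x ∈ t', ∑ y ∈ s, adjWeight G x y * (f x * f y) ≤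
      (∑ x ∈ K, (G.degree x : ℝ)) * n2 := by
    calc ∑ x ∈ t', ∑ y ∈ s, adjWeight G x y * (f x * f y)
        ≤ ∑ x ∈ t', (G.degree x : ℝ) * n2 := by
          refine Finset.sum_le_sum fun x hx => ?_
          have hxs : x ∈ s := (Finset.mem_filter.1 hx).1
          calc ∑ y ∈ s, adjWeight G x y * (f x * f y) ≤ ∑ y ∈ s, adjWeight G x y * n2 :=
                Finset.sum_le_sum fun y hy =>
                  mul_le_mul_of_nonneg_left (hprod x hxs y hy) (adjWeight_nonneg G x y)
            _ = (∑ y ∈ s, adjWeight G x y) * n2 := by rw [Finset.sum_mul]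
            _ ≤ _ := mul_le_mul_of_nonneg_right (sum_adjWeight_le_degree G s x) hn0
      _ ≤ ∑ x ∈ K, (G.degree x : ℝ) * n2 := by
          refine Finset.sum_le_sum_of_subset_of_nonneg (fun x hx => (Finset.mem_filter.1 hx).2)
            fun x _ _ => by positivity
      _ = _ := by rw [Finset.sum_mul]
  have hcross' : ∑ x ∈ t, ∑ y ∈ t', adjWeight G x y * (f x * f y) ≤
      (∑ x ∈ K, (G.degree x : ℝ)) * n2 := by
    refine le_trans ?_ hcross
    rw [Finset.sum_comm]
    refine Finset.sum_le_sum fun y _ => ?_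
    calc ∑ x ∈ t, adjWeight G x y * (f x * f y) = ∑ x ∈ t, adjWeight G y x * (f y * f x) :=
          Finset.sum_congr rfl fun x _ => by rw [adjWeight_comm, mul_comm (f x)]
      _ ≤ ∑ x ∈ s, adjWeight G y x * (f y * f x) :=
          Finset.sum_le_sum_of_subset_of_nonneg (Finset.filter_subset _ _) fun x _ _ => hnn y x
  have hmain := sum_mul_mul_le_sqrt (w := adjWeight G) (g := degPot G q) (β := β) t
    (cheegerConst_nonneg G hq _) (adjWeight_nonneg G) (adjWeight_comm G)
    (fun x _ => sum_adjWeight_le_degPot G hq t x)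
    (fun W hW => sum_sum_adjWeight_le G hq fun x hx => (Finset.mem_filter.1 (hW hx)).2) f hf
  have hDle : ∑ x ∈ t, degPot G q x * f x ^ 2 ≤ ∑ x ∈ s, degPot G q x * f x ^ 2 :=
    Finset.sum_le_sum_of_subset_of_nonneg (Finset.filter_subset _ _) fun x _ _ =>
      mul_nonneg (degPot_nonneg G hq x) (sq_nonneg _)
  have hDle' := mul_le_mul_of_nonneg_left hDle (Real.sqrt_nonneg (1 - β ^ 2))
  rw [hsplit fun x => ∑ y ∈ s, adjWeight G x y * (f x * f y)]
  have h5 : ∑ x ∈ t, ∑ y ∈ s, adjWeight G x y * (f x * f y) =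
      ∑ x ∈ t, ∑ y ∈ t', adjWeight G x y * (f x * f y) +
        ∑ x ∈ t, ∑ y ∈ t, adjWeight G x y * (f x * f y) := by
    rw [← Finset.sum_add_distrib]
    exact Finset.sum_congr rfl fun x _ => hsplit _
  rw [h5]
  linarith

/-- The case `β = 0` of Cheeger's inequality, where the isoperimetric hypothesis is the trivial
degree bound. It serves to show `Δ + q ≥ 0`. -/
theorem sum_adjWeight_mul_le_degPot (hq : ∀ x, 0 ≤ q x) (s : Finset V) (f : V → ℝ)
    (hf : ∀ x, 0 ≤ f x) : ∑ x ∈ s, ∑ y ∈ s, adjWeight G x y * (f x * f y) ≤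
      ∑ x ∈ s, degPot G q x * f x ^ 2 := by
  have := sum_mul_mul_le_sqrt (w := adjWeight G) (g := degPot G q) (β := 0) s le_rfl
    (adjWeight_nonneg G) (adjWeight_comm G) (fun x _ => sum_adjWeight_le_degPot G hq s x)
    (fun W _ => by
      rw [sub_zero, one_mul]
      exact Finset.sum_le_sum fun x _ => sum_adjWeight_le_degPot G hq W x) f hf
  simpa using this

/-! ### The Cheeger constant at infinity -/

theorem cheegerConst_compl_le_cheegerInfty (hq : ∀ x, 0 ≤ q x) (K : Finset V) :
    cheegerConst G q ((K : Set V)ᶜ) ≤ cheegerInfty G q :=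
  le_ciSup (f := fun K : Finset V => cheegerConst G q ((K : Set V)ᶜ))
    ⟨1, by rintro _ ⟨K, rfl⟩; exact cheegerConst_le_one G hq _⟩ K

/-- Any inequality between continuous functions that holds strictly at the Cheeger constant at
infinity holds at the Cheeger constant of the complement of some finite set. -/
theorem exists_finset_of_eventually_cheegerInfty (hq : ∀ x, 0 ≤ q x) {p : ℝ → Prop}
    (hp : ∀ᶠ β in 𝓝 (cheegerInfty G q), p β) :
    ∃ K : Finset V, p (cheegerConst G q ((K : Set V)ᶜ)) := by
  -- A left neighbourhood suffices, since the constants approach their supremum from below.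
  obtain ⟨l, hl, hlp⟩ := exists_Ioc_subset_of_mem_nhds hp (exists_lt _)
  obtain ⟨K, hK⟩ := exists_lt_of_lt_ciSup hl
  exact ⟨K, hlp ⟨hK, cheegerConst_compl_le_cheegerInfty G hq K⟩⟩

end Graph

section MaximalOperators

variable {V : Type*}

/-! ### Maximal operators with finitely supported columns -/

open scoped Classical in
/-- The standard basis vector of `ℓ²(V)` at `x`. -/
noncomputable def stdVec (x : V) : ℓ²(V, ℂ) := lp.single 2 x 1

open scoped Classical in
theorem stdVec_apply (x y : V) : stdVec x y = if y = x then 1 else 0 := by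
  unfold stdVec
  rw [lp.single_apply]
  by_cases h : y = x
  · subst h; simp
  · simp [h]

theorem inner_stdVec_left (x : V) (z : ℓ²(V, ℂ)) : ⟪stdVec x, z⟫_ℂ = z x := by
  classical
  have : stdVec x = lp.single 2 x (1 : ℂ) := by unfold stdVec; congr
  rw [this, lp.inner_single_left]
  simp

theorem stdVec_mem_Cc (x : V) : stdVec x ∈ Cc V := by
  refine (Set.finite_singleton x).subset fun y hy => ?_
  by_contra h
  have h : y ≠ x := h
  exact hy (by rw [stdVec_apply, if_neg h])

theorem sum_smul_stdVec_apply (s : Finset V) (a : V → ℂ) (y : V) :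
    (∑ x ∈ s, a x • stdVec x : ℓ²(V, ℂ)) y = ∑ x ∈ s, a x * stdVec x y := by
  rw [lp.coeFn_sum, Finset.sum_apply]
  rfl

theorem eq_sum_smul_stdVec {s : Finset V} {φ : ℓ²(V, ℂ)} (hs : ∀ x ∉ s, φ x = 0) :
    φ = ∑ x ∈ s, φ x • stdVec x := by
  classical
  ext y
  rw [sum_smul_stdVec_apply]
  simp only [stdVec_apply, mul_ite, mul_one, mul_zero, Finset.sum_ite_eq]
  split_ifs with h
  · rfl
  · exact hs y h

theorem exists_finset_of_mem_Cc {φ : ℓ²(V, ℂ)} (hφ : φ ∈ Cc V) :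
    ∃ s : Finset V, ∀ x ∉ s, φ x = 0 := by
  have hφ : (Function.support (φ : V → ℂ)).Finite := hφ
  refine ⟨hφ.toFinset, fun x hx => ?_⟩
  simpa using hx

theorem norm_sq_eq_sum {s : Finset V} {φ : ℓ²(V, ℂ)} (hs : ∀ x ∉ s, φ x = 0) :
    ‖φ‖ ^ 2 = ∑ x ∈ s, ‖φ x‖ ^ 2 := by
  have h := lp.norm_rpow_eq_tsum (p := 2) (by norm_num) φ
  rw [tsum_eq_sum (s := s) fun x hx => by simp [hs x hx]] at h
  simpa using h

theorem mem_graph_maximalOperator {L : (V → ℂ) →ₗ[ℂ] (V → ℂ)} {x y : ℓ²(V, ℂ)} :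
    (x, y) ∈ (maximalOperator L).graph ↔ L (x : V → ℂ) = (y : V → ℂ) := by
  rw [LinearPMap.mem_graph_iff]
  constructor
  · rintro ⟨⟨x', hx'⟩, rfl, rfl⟩
    rfl
  · intro h
    refine ⟨⟨x, ?_⟩, rfl, ?_⟩
    · change Memℓp (L (x : V → ℂ)) 2
      rw [h]
      exact y.2
    · exact Subtype.ext h

/-- `L` is given by a Hermitian matrix whose columns `col x` are square-summable. -/
structure HasColumns (L : (V → ℂ) →ₗ[ℂ] (V → ℂ)) (col : V → ℓ²(V, ℂ)) : Prop where
  apply_eq_inner : ∀ (x : V) (z : ℓ²(V, ℂ)), L (z : V → ℂ) x = ⟪col x, z⟫_ℂ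
  apply_stdVec : ∀ x : V, L (stdVec x : V → ℂ) = (col x : V → ℂ)

namespace HasColumns

variable {L : (V → ℂ) →ₗ[ℂ] (V → ℂ)} {col : V → ℓ²(V, ℂ)}

theorem isClosed_graph (h : HasColumns L col) :
    IsClosed ((maximalOperator L).graph : Set (ℓ²(V, ℂ) × ℓ²(V, ℂ))) := by
  have : ((maximalOperator L).graph : Set (ℓ²(V, ℂ) × ℓ²(V, ℂ))) =
      ⋂ x : V, {p | ⟪col x, p.1⟫_ℂ = ⟪stdVec x, p.2⟫_ℂ} := by
    ext ⟨x, y⟩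
    rw [SetLike.mem_coe, mem_graph_maximalOperator, Set.mem_iInter, funext_iff]
    refine forall_congr' fun v => ?_
    rw [Set.mem_ofPred_eq, inner_stdVec_left, h.apply_eq_inner]
  rw [this]
  exact isClosed_iInter fun x => isClosed_eq (by fun_prop) (by fun_prop)

theorem mem_graph_sum (h : HasColumns L col) {s : Finset V} {φ : ℓ²(V, ℂ)}
    (hs : ∀ x ∉ s, φ x = 0) : (φ, ∑ x ∈ s, φ x • col x) ∈ (maximalOperator L).graph := by
  have h1 : ∑ x ∈ s, φ x • ((stdVec x : ℓ²(V, ℂ)), col x) ∈ (maximalOperator L).graph :=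
    Submodule.sum_mem _ fun x _ => Submodule.smul_mem _ _
      (mem_graph_maximalOperator.2 (h.apply_stdVec x))
  convert h1 using 1
  ext1
  · rw [Prod.fst_sum]
    exact eq_sum_smul_stdVec hs
  · rw [Prod.snd_sum]
    rfl

theorem Cc_le_domain (h : HasColumns L col) : Cc V ≤ (maximalOperator L).domain := by
  intro φ hφ
  obtain ⟨s, hs⟩ := exists_finset_of_mem_Cc hφ
  exact LinearPMap.mem_domain_of_mem_graph (h.mem_graph_sum hs)

/-- The restriction of the maximal operator to the finitely supported functions. -/
noncomputable def coreMap (h : HasColumns L col) : Cc V →ₗ[ℂ] ℓ²(V, ℂ) :=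
  (maximalOperator L).toFun ∘ₗ Submodule.inclusion h.Cc_le_domain

theorem coreMap_mem_graph (h : HasColumns L col) (φ : Cc V) :
    ((φ : ℓ²(V, ℂ)), h.coreMap φ) ∈ (maximalOperator L).graph :=
  (maximalOperator L).mem_graph (Submodule.inclusion h.Cc_le_domain φ)

theorem coreMap_apply (h : HasColumns L col) (φ : Cc V) (x : V) :
    h.coreMap φ x = L ((φ : ℓ²(V, ℂ)) : V → ℂ) x := rfl

theorem inner_coreMap_left (h : HasColumns L col) {s : Finset V} {φ : Cc V}
    (hs : ∀ x ∉ s, (φ : ℓ²(V, ℂ)) x = 0) (z : ℓ²(V, ℂ)) :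
    ⟪h.coreMap φ, z⟫_ℂ = ∑ x ∈ s, (starRingEnd ℂ) ((φ : ℓ²(V, ℂ)) x) * L (z : V → ℂ) x := by
  have h1 := LinearPMap.mem_graph_snd_inj _ (h.coreMap_mem_graph φ) (h.mem_graph_sum hs) rfl
  rw [h1, sum_inner]
  refine Finset.sum_congr rfl fun x _ => ?_
  rw [inner_smul_left, h.apply_eq_inner]

theorem inner_coreMap_symm (h : HasColumns L col) (φ ψ : Cc V) :
    ⟪h.coreMap φ, (ψ : ℓ²(V, ℂ))⟫_ℂ = ⟪(φ : ℓ²(V, ℂ)), h.coreMap ψ⟫_ℂ := by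
  obtain ⟨s, hs⟩ := exists_finset_of_mem_Cc φ.2
  rw [h.inner_coreMap_left hs]
  conv_rhs => rw [eq_sum_smul_stdVec hs, sum_inner]
  refine Finset.sum_congr rfl fun x _ => ?_
  rw [inner_smul_left, inner_stdVec_left, h.coreMap_apply]

/-- Testing a vector `z` orthogonal to the range against each `stdVec x` gives `L z = -z` at `x`. So
`z` lies in the maximal domain as an eigenvector for `-1`, and vanishes by hypothesis. -/
theorem denseRange (h : HasColumns L col)
    (hinj : ∀ x, (x, -x) ∈ (maximalOperator L).graph → x = 0) :
    DenseRange (fun φ : Cc V => (φ : ℓ²(V, ℂ)) + h.coreMap φ) := by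
  have h1 : (LinearMap.range ((Cc V).subtype + h.coreMap)).topologicalClosure = ⊤ := by
    rw [Submodule.topologicalClosure_eq_top_iff, Submodule.eq_bot_iff]
    intro z hz
    apply hinj
    rw [mem_graph_maximalOperator]
    ext x
    have h2 := (Submodule.mem_orthogonal _ _).1 hz _ ⟨⟨stdVec x, stdVec_mem_Cc x⟩, rfl⟩
    have h3 : h.coreMap ⟨stdVec x, stdVec_mem_Cc x⟩ = col x :=
      LinearPMap.mem_graph_snd_inj _ (h.coreMap_mem_graph ⟨stdVec x, stdVec_mem_Cc x⟩)
        (mem_graph_maximalOperator.2 (h.apply_stdVec x)) rfl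
    rw [LinearMap.add_apply, h3, inner_add_left, ← h.apply_eq_inner] at h2
    have h4 : ⟪(Cc V).subtype ⟨stdVec x, stdVec_mem_Cc x⟩, z⟫_ℂ = z x := inner_stdVec_left x z
    rw [h4] at h2
    exact eq_neg_of_add_eq_zero_right h2
  exact Submodule.dense_iff_topologicalClosure_eq_top.2 h1

theorem exists_resolvent (h : HasColumns L col)
    (hinj : ∀ x, (x, -x) ∈ (maximalOperator L).graph → x = 0)
    (hnonneg : ∀ φ : Cc V, 0 ≤ (⟪h.coreMap φ, (φ : ℓ²(V, ℂ))⟫_ℂ).re) :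
    ∃ R : ℓ²(V, ℂ) →L[ℂ] ℓ²(V, ℂ), IsNegOneResolvent (maximalOperator L) R :=
  exists_isNegOneResolvent h.coreMap h.coreMap_mem_graph h.inner_coreMap_symm hnonneg
    (h.denseRange hinj) h.isClosed_graph hinj

end HasColumns

/-! ### Form bounds on the full domain and compactness of the resolvent -/

/-- The linear combination of a form and the norm extends from a core to the domain. -/
theorem form_lower_bound_of_core {T : ℓ²(V, ℂ) →ₗ.[ℂ] ℓ²(V, ℂ)} {R : ℓ²(V, ℂ) →L[ℂ] ℓ²(V, ℂ)}
    (hR : IsNegOneResolvent T R) {C : Submodule ℂ ℓ²(V, ℂ)} (A : C →ₗ[ℂ] ℓ²(V, ℂ))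
    (hA : ∀ φ : C, ((φ : ℓ²(V, ℂ)), A φ) ∈ T.graph)
    (hdense : DenseRange (fun φ : C => (φ : ℓ²(V, ℂ)) + A φ)) {g : V → ℝ} {c k : ℝ}
    (s : Finset V) (hle : ∀ φ : C, c * ∑ x ∈ s, g x * ‖(φ : ℓ²(V, ℂ)) x‖ ^ 2 ≤
      (⟪A φ, (φ : ℓ²(V, ℂ))⟫_ℂ).re + k * ‖(φ : ℓ²(V, ℂ))‖ ^ 2)
    {x y : ℓ²(V, ℂ)} (hxy : (x, y) ∈ T.graph) :
    c * ∑ v ∈ s, g v * ‖x v‖ ^ 2 ≤ (⟪y, x⟫_ℂ).re + k * ‖x‖ ^ 2 := by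
  -- Parametrising the graph as `(R u, u - R u)` makes both sides continuous in `u`, so it suffices
  -- to check the dense set `u = φ + A φ`.
  have key : ∀ u, c * ∑ v ∈ s, g v * ‖⟪stdVec v, R u⟫_ℂ‖ ^ 2 ≤
      (⟪u - R u, R u⟫_ℂ).re + k * ‖R u‖ ^ 2 := by
    intro u
    refine hdense.induction_on (p := fun u => c * ∑ v ∈ s, g v * ‖⟪stdVec v, R u⟫_ℂ‖ ^ 2 ≤
      (⟪u - R u, R u⟫_ℂ).re + k * ‖R u‖ ^ 2) u (isClosed_le (by fun_prop) ?_) ?_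
    · exact (Complex.continuous_re.comp (by fun_prop)).add (by fun_prop)
    · intro φ
      rw [(hR.mem_graph_iff _ _).1 (hA φ), add_sub_cancel_left]
      simp only [inner_stdVec_left]
      exact hle φ
  have := key (x + y)
  rw [(hR.mem_graph_iff _ _).1 hxy, add_sub_cancel_left] at this
  simpa only [inner_stdVec_left] using this

/-- If the form of `T` controls multiplication by a function tending to infinity, then the
resolvent of `T` is compact. -/
theorem isCompactOperator_of_form_lower_bound {T : ℓ²(V, ℂ) →ₗ.[ℂ] ℓ²(V, ℂ)}
    {R : ℓ²(V, ℂ) →L[ℂ] ℓ²(V, ℂ)} (hR : IsNegOneResolvent T R) {g : V → ℝ} {c k : ℝ}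
    (hc : 0 < c) (hk : 0 ≤ k) (hg0 : ∀ x, 0 ≤ g x) (hg : ∀ t, {x | g x ≤ t}.Finite)
    (hle : ∀ x y, (x, y) ∈ T.graph → ∀ s : Finset V,
      c * ∑ v ∈ s, g v * ‖x v‖ ^ 2 ≤ (⟪y, x⟫_ℂ).re + k * ‖x‖ ^ 2) : IsCompactOperator R := by
  set M : ℝ := (1 + ‖R‖) * ‖R‖ + k * ‖R‖ ^ 2 with hM
  have hM0 : 0 ≤ M := by positivity
  have hbound : ∀ u (s : Finset V), c * ∑ v ∈ s, g v * ‖R u v‖ ^ 2 ≤ M * ‖u‖ ^ 2 := by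
    intro u s
    refine (hle _ _ (hR.mem_graph u) s).trans ?_
    have h1 : (⟪u - R u, R u⟫_ℂ).re ≤ ‖u - R u‖ * ‖R u‖ := re_inner_le_norm (𝕜 := ℂ) _ _
    have h2 : ‖R u‖ ≤ ‖R‖ * ‖u‖ := R.le_opNorm u
    have h3 : ‖u - R u‖ ≤ ‖u‖ + ‖R u‖ := norm_sub_le _ _
    have h4 : ‖u - R u‖ ≤ (1 + ‖R‖) * ‖u‖ := by linarith
    have h5 : ‖u - R u‖ * ‖R u‖ ≤ ((1 + ‖R‖) * ‖u‖) * (‖R‖ * ‖u‖) := by gcongr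
    have h6 : k * ‖R u‖ ^ 2 ≤ k * (‖R‖ * ‖u‖) ^ 2 := by gcongr
    calc _ ≤ ((1 + ‖R‖) * ‖u‖) * (‖R‖ * ‖u‖) + k * (‖R‖ * ‖u‖) ^ 2 := by linarith
      _ = _ := by rw [hM]; ring
  classical
  set S : ℕ → Finset V := fun n => (hg (n + 1)).toFinset with hS
  -- Finite-rank projections onto the coordinates with `g ≤ n + 1`. On the other coordinates the
  -- form bound gains a factor `1 / (n + 1)`, so `P n ∘ R` tends to `R` in norm.
  set P : ℕ → ℓ²(V, ℂ) →L[ℂ] ℓ²(V, ℂ) := fun n =>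
    ∑ x ∈ S n, (innerSL ℂ (stdVec x)).smulRight (stdVec x) with hP
  have hPapp : ∀ n z, P n z = ∑ x ∈ S n, z x • stdVec x := by
    intro n z
    simp only [hP, _root_.sum_apply, ContinuousLinearMap.smulRight_apply,
      innerSL_apply_apply, inner_stdVec_left]
  have hPcomp : ∀ n, IsCompactOperator (P n) := by
    intro n
    have : P n ∈ compactOperator (RingHom.id ℂ) ℓ²(V, ℂ) ℓ²(V, ℂ) := by
      refine Submodule.sum_mem _ fun x _ => ?_
      have h1 : IsCompactOperator (innerSL ℂ (stdVec x)) :=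
        isCompactOperator_of_locallyCompactSpace_dom _
      have h2 := h1.clm_comp ((ContinuousLinearMap.id ℂ ℂ).smulRight (stdVec x))
      exact h2
    exact this
  have hPz : ∀ n z v, (P n z - z) v = if v ∈ S n then 0 else -z v := by
    intro n z v
    rw [hPapp, lp.coeFn_sub, Pi.sub_apply, sum_smul_stdVec_apply]
    simp only [stdVec_apply, mul_ite, mul_one, mul_zero, Finset.sum_ite_eq]
    split_ifs <;> simp
  have hdiff : ∀ n : ℕ, ‖P n ∘L R - R‖ ≤ √(M / c / ((n : ℝ) + 1)) := by
    intro n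
    refine ContinuousLinearMap.opNorm_le_bound _ (Real.sqrt_nonneg _) fun u => ?_
    refine lp.norm_le_of_forall_sum_le (p := 2) (by norm_num) (by positivity) fun s => ?_
    have hn : (0 : ℝ) < (n : ℝ) + 1 := by positivity
    have h1 : ∀ v ∈ s, ‖(P n (R u) - R u) v‖ ^ 2 ≤ (g v * ‖R u v‖ ^ 2) / ((n : ℝ) + 1) := by
      intro v _
      rw [hPz]
      split_ifs with hv
      · have := hg0 v
        rw [norm_zero, zero_pow two_ne_zero]
        positivity
      · have hv' : (n : ℝ) + 1 ≤ g v := by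
          by_contra hlt
          exact hv (by simpa [hS] using (not_le.1 hlt).le)
        rw [norm_neg, le_div_iff₀ hn, mul_comm]
        gcongr
    have h2 : ∑ v ∈ s, ‖(P n (R u) - R u) v‖ ^ 2 ≤ M / c / ((n : ℝ) + 1) * ‖u‖ ^ 2 := by
      refine (Finset.sum_le_sum h1).trans ?_
      rw [← Finset.sum_div, div_mul_eq_mul_div]
      gcongr
      rw [div_mul_eq_mul_div, le_div_iff₀ hc, mul_comm]
      exact hbound u s
    have h3 : ((√(M / c / ((n : ℝ) + 1)) * ‖u‖) ^ 2 : ℝ) = M / c / ((n : ℝ) + 1) * ‖u‖ ^ 2 := by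
      rw [mul_pow, Real.sq_sqrt (by positivity)]
    rw [← h3] at h2
    simpa using h2
  refine isCompactOperator_of_tendsto (F := fun n => P n ∘L R) (l := atTop) ?_
    (Eventually.of_forall fun n => (hPcomp n).comp_clm R)
  rw [tendsto_iff_norm_sub_tendsto_zero]
  refine squeeze_zero (fun n => norm_nonneg _) hdiff ?_
  have h1 : Tendsto (fun n : ℕ => M / c / ((n : ℝ) + 1)) atTop (𝓝 0) := by
    have := (tendsto_one_div_add_atTop_nhds_zero_nat (𝕜 := ℝ)).const_mul (M / c)
    rw [mul_zero] at this
    exact this.congr fun n => by ring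
  have h2 := (Real.continuous_sqrt.tendsto 0).comp h1
  rwa [Real.sqrt_zero] at h2

end MaximalOperators

section Multiplication

variable {V : Type*}

/-! ### Multiplication operators -/

theorem hasColumns_formalMul (g : V → ℝ) :
    HasColumns (formalMul g) fun x => (g x : ℂ) • stdVec x where
  apply_eq_inner x z := by
    rw [inner_smul_left, inner_stdVec_left, Complex.conj_ofReal]
    rfl
  apply_stdVec x := by
    ext v
    change (g v : ℂ) * stdVec x v = (g x : ℂ) * stdVec x v
    rw [stdVec_apply]
    split_ifs with h
    · rw [h]
    · simp

theorem eq_zero_of_mem_graph_formalMul {g : V → ℝ} (hg : ∀ x, 0 ≤ g x) (x : ℓ²(V, ℂ))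
    (hx : (x, -x) ∈ (maximalOperator (formalMul g)).graph) : x = 0 := by
  rw [mem_graph_maximalOperator] at hx
  ext v
  have h1 : (g v : ℂ) * x v = -x v := congrFun hx v
  have h2 : ((g v + 1 : ℝ) : ℂ) * x v = 0 := by push_cast; linear_combination h1
  have h3 : ((g v + 1 : ℝ) : ℂ) ≠ 0 := Complex.ofReal_ne_zero.2 (by linarith [hg v])
  exact (mul_eq_zero.1 h2).resolve_left h3

theorem re_inner_coreMap_formalMul (g : V → ℝ) {φ : Cc V} {s : Finset V}
    (hs : ∀ x ∉ s, (φ : ℓ²(V, ℂ)) x = 0) :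
    (⟪(hasColumns_formalMul g).coreMap φ, (φ : ℓ²(V, ℂ))⟫_ℂ).re =
      ∑ x ∈ s, g x * ‖(φ : ℓ²(V, ℂ)) x‖ ^ 2 := by
  rw [HasColumns.inner_coreMap_left _ hs, Complex.re_sum]
  refine Finset.sum_congr rfl fun x _ => ?_
  change ((starRingEnd ℂ) ((φ : ℓ²(V, ℂ)) x) * ((g x : ℂ) * (φ : ℓ²(V, ℂ)) x)).re = _
  rw [mul_left_comm, ← Complex.normSq_eq_conj_mul_self, Complex.normSq_eq_norm_sq,
    ← Complex.ofReal_mul, Complex.ofReal_re]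

theorem re_inner_coreMap_formalMul_nonneg {g : V → ℝ} (hg : ∀ x, 0 ≤ g x) (φ : Cc V) :
    0 ≤ (⟪(hasColumns_formalMul g).coreMap φ, (φ : ℓ²(V, ℂ))⟫_ℂ).re := by
  obtain ⟨s, hs⟩ := exists_finset_of_mem_Cc φ.2
  rw [re_inner_coreMap_formalMul g hs]
  exact Finset.sum_nonneg fun x _ => mul_nonneg (hg x) (sq_nonneg _)

/-- The sum over any finite set is bounded by the form. -/
theorem sum_le_re_inner_coreMap_formalMul {g : V → ℝ} (hg : ∀ x, 0 ≤ g x) (φ : Cc V)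
    (t : Finset V) : ∑ x ∈ t, g x * ‖(φ : ℓ²(V, ℂ)) x‖ ^ 2 ≤
      (⟪(hasColumns_formalMul g).coreMap φ, (φ : ℓ²(V, ℂ))⟫_ℂ).re := by
  classical
  obtain ⟨s, hs⟩ := exists_finset_of_mem_Cc φ.2
  rw [re_inner_coreMap_formalMul g (s := s ∪ t) fun x hx => hs x fun h =>
    hx (Finset.mem_union_left _ h)]
  exact Finset.sum_le_sum_of_subset_of_nonneg Finset.subset_union_right fun x _ _ =>
    mul_nonneg (hg x) (sq_nonneg _)

/-- The standard basis of `ℓ²(V)`. -/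
noncomputable def stdHilbertBasis (V : Type*) : HilbertBasis V ℂ ℓ²(V, ℂ) :=
  HilbertBasis.ofRepr (LinearIsometryEquiv.refl ℂ ℓ²(V, ℂ))

theorem stdHilbertBasis_apply (x : V) : stdHilbertBasis V x = stdVec x := by
  classical
  rw [← (stdHilbertBasis V).repr_symm_single]
  unfold stdVec
  change (lp.single 2 x (1 : ℂ) : ℓ²(V, ℂ)) = _
  congr

theorem stdHilbertBasis_mem_graph (g : V → ℝ) (x : V) :
    (stdHilbertBasis V x, (g x : ℂ) • stdHilbertBasis V x) ∈
      (maximalOperator (formalMul g)).graph := by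
  rw [stdHilbertBasis_apply, mem_graph_maximalOperator]
  exact (hasColumns_formalMul g).apply_stdVec x

end Multiplication

section Schrodinger

variable {V : Type*} (G : SimpleGraph V) [G.LocallyFinite] (q : V → ℝ)

/-! ### Schrödinger operators -/

/-- The columns of the matrix of the Schrödinger operator. -/
noncomputable def schrodingerCol (x : V) : ℓ²(V, ℂ) :=
  (degPot G q x : ℂ) • stdVec x - ∑ y ∈ G.neighborFinset x, stdVec y

theorem formalSchrodinger_apply (f : V → ℂ) (x : V) : formalSchrodinger G q f x =
    (degPot G q x : ℂ) * f x - ∑ y ∈ G.neighborFinset x, f y := by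
  change ∑ w ∈ G.neighborFinset x, (f x - f w) + (q x : ℂ) * f x = _
  rw [Finset.sum_sub_distrib, Finset.sum_const, G.card_neighborFinset_eq_degree, degPot]
  push_cast
  rw [nsmul_eq_mul]
  ring

theorem hasColumns_formalSchrodinger :
    HasColumns (formalSchrodinger G q) (schrodingerCol G q) where
  apply_eq_inner x z := by
    rw [formalSchrodinger_apply, schrodingerCol, inner_sub_left, inner_smul_left, sum_inner,
      Complex.conj_ofReal]
    simp only [inner_stdVec_left]
  apply_stdVec x := by
    classical
    ext v
    rw [formalSchrodinger_apply, schrodingerCol, lp.coeFn_sub, Pi.sub_apply, lp.coeFn_smul,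
      Pi.smul_apply, smul_eq_mul, lp.coeFn_sum, Finset.sum_apply]
    simp only [stdVec_apply]
    have h1 : ∑ y ∈ G.neighborFinset v, (if y = x then (1 : ℂ) else 0) =
        ∑ y ∈ G.neighborFinset x, (if v = y then (1 : ℂ) else 0) := by
      rw [Finset.sum_ite_eq', Finset.sum_ite_eq]
      simp only [SimpleGraph.mem_neighborFinset]
      exact if_congr (G.adj_comm v x) rfl rfl
    rw [h1]
    congr 1
    split_ifs with h
    · rw [h]
    · simp

variable {q}

/-- The maximum principle: `-1` is not an eigenvalue of the Schrödinger operator. -/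
theorem eq_zero_of_mem_graph_formalSchrodinger (hq : ∀ x, 0 ≤ q x) (x : ℓ²(V, ℂ))
    (hx : (x, -x) ∈ (maximalOperator (formalSchrodinger G q)).graph) : x = 0 := by
  rw [mem_graph_maximalOperator] at hx
  by_contra hne
  obtain ⟨v₀, hv₀⟩ : ∃ v, x v ≠ 0 := by
    by_contra! h
    exact hne (lp.ext (funext h))
  -- Values of a square-summable function tend to zero, so only finitely many vertices compete and
  -- `‖x v‖` attains its maximum.
  have hfin : {v | ‖x v₀‖ ≤ ‖x v‖}.Finite := by
    have h1 := ((lp.memℓp x).summable (p := 2) (by norm_num)).tendsto_cofinite_zero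
    have h2 : (0 : ℝ) < ‖x v₀‖ ^ (2 : ENNReal).toReal :=
      Real.rpow_pos_of_pos (norm_pos_iff.2 hv₀) _
    have h3 := h1.eventually (gt_mem_nhds h2)
    refine (Filter.eventually_cofinite.1 h3).subset fun v hv => ?_
    exact not_lt.2 (Real.rpow_le_rpow (norm_nonneg _) hv (by norm_num))
  obtain ⟨v, hv, hmax⟩ := hfin.toFinset.exists_max_image (fun v => ‖x v‖) ⟨v₀, by simp⟩
  have hv : ‖x v₀‖ ≤ ‖x v‖ := by simpa using hv
  have hmax' : ∀ w, ‖x w‖ ≤ ‖x v‖ := by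
    intro w
    rcases le_total ‖x v₀‖ ‖x w‖ with h | h
    · exact hmax w (by simpa using h)
    · exact h.trans hv
  have hpos : 0 < ‖x v‖ := (norm_pos_iff.2 hv₀).trans_le hv
  have h1 : formalSchrodinger G q x v = -x v := congrFun hx v
  rw [formalSchrodinger_apply] at h1
  have h2 : ((degPot G q v + 1 : ℝ) : ℂ) * x v = ∑ y ∈ G.neighborFinset v, x y := by
    push_cast; linear_combination h1
  have h3 : (degPot G q v + 1) * ‖x v‖ ≤ (G.degree v : ℝ) * ‖x v‖ := by
    have h4 : (degPot G q v + 1) * ‖x v‖ = ‖((degPot G q v + 1 : ℝ) : ℂ) * x v‖ := by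
      rw [norm_mul, Complex.norm_real, Real.norm_eq_abs,
        abs_of_nonneg (by linarith [degPot_nonneg G hq v])]
    rw [h4, h2]
    refine (norm_sum_le_of_le _ fun y _ => hmax' y).trans_eq ?_
    rw [Finset.sum_const, G.card_neighborFinset_eq_degree, nsmul_eq_mul]
  have h5 := le_of_mul_le_mul_right h3 hpos
  have h6 : degPot G q v = (G.degree v : ℝ) + q v := rfl
  linarith [hq v]

/-- The diagonal parts cancel and only the adjacency form remains. Passing to absolute values
controls it from both sides at once and reduces to non-negative real functions, as Cheeger's
inequality requires. -/
theorem abs_re_inner_coreMap_sub_le {φ : Cc V} {s : Finset V}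
    (hs : ∀ x ∉ s, (φ : ℓ²(V, ℂ)) x = 0) :
    |(⟪(hasColumns_formalSchrodinger G q).coreMap φ, (φ : ℓ²(V, ℂ))⟫_ℂ).re -
        (⟪(hasColumns_formalMul (degPot G q)).coreMap φ, (φ : ℓ²(V, ℂ))⟫_ℂ).re| ≤
      ∑ x ∈ s, ∑ y ∈ s, adjWeight G x y *
        (‖(φ : ℓ²(V, ℂ)) x‖ * ‖(φ : ℓ²(V, ℂ)) y‖) := by
  classical
  rw [← Complex.sub_re, HasColumns.inner_coreMap_left _ hs, HasColumns.inner_coreMap_left _ hs,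
    ← Finset.sum_sub_distrib]
  refine (Complex.abs_re_le_norm _).trans (norm_sum_le_of_le _ fun x _ => ?_)
  have h1 : formalSchrodinger G q ((φ : ℓ²(V, ℂ)) : V → ℂ) x =
      formalMul (degPot G q) ((φ : ℓ²(V, ℂ)) : V → ℂ) x -
        ∑ y ∈ G.neighborFinset x, (φ : ℓ²(V, ℂ)) y := formalSchrodinger_apply G q _ x
  have h2 : ∑ y ∈ G.neighborFinset x, (φ : ℓ²(V, ℂ)) y =
      ∑ y ∈ s, (adjWeight G x y : ℂ) * (φ : ℓ²(V, ℂ)) y := by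
    have h3 : ∀ y ∈ s, (adjWeight G x y : ℂ) * (φ : ℓ²(V, ℂ)) y =
        if y ∈ G.neighborFinset x then (φ : ℓ²(V, ℂ)) y else 0 := by
      intro y _
      unfold adjWeight
      by_cases h : G.Adj x y <;> simp [h]
    rw [Finset.sum_congr rfl h3, ← Finset.sum_filter]
    refine (Finset.sum_subset (fun y hy => (Finset.mem_filter.1 hy).2) fun y hy hy' => ?_).symm
    refine hs y fun hys => hy' (Finset.mem_filter.2 ⟨hys, hy⟩)
  rw [← mul_sub, h1, sub_sub_cancel_left, h2, norm_mul, RCLike.norm_conj, norm_neg]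
  calc ‖(φ : ℓ²(V, ℂ)) x‖ * ‖∑ y ∈ s, (adjWeight G x y : ℂ) * (φ : ℓ²(V, ℂ)) y‖
      ≤ ‖(φ : ℓ²(V, ℂ)) x‖ * ∑ y ∈ s, adjWeight G x y * ‖(φ : ℓ²(V, ℂ)) y‖ := by
        refine mul_le_mul_of_nonneg_left (norm_sum_le_of_le _ fun y _ => ?_) (norm_nonneg _)
        rw [norm_mul, Complex.norm_real, Real.norm_eq_abs, abs_of_nonneg (adjWeight_nonneg G x y)]
    _ = _ := by
        rw [Finset.mul_sum]
        exact Finset.sum_congr rfl fun y _ => by ring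

theorem re_inner_coreMap_formalSchrodinger_nonneg (hq : ∀ x, 0 ≤ q x) (φ : Cc V) :
    0 ≤ (⟪(hasColumns_formalSchrodinger G q).coreMap φ, (φ : ℓ²(V, ℂ))⟫_ℂ).re := by
  obtain ⟨s, hs⟩ := exists_finset_of_mem_Cc φ.2
  have h1 := abs_re_inner_coreMap_sub_le G (q := q) hs
  have h2 := sum_adjWeight_mul_le_degPot G hq s (fun x => ‖(φ : ℓ²(V, ℂ)) x‖)
    fun x => norm_nonneg _
  rw [← re_inner_coreMap_formalMul (degPot G q) hs] at h2
  linarith [(abs_le.1 h1).1]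

/-- The forms of `Δ + q` and `deg + q` differ by at most a multiple of `deg + q` determined by the
Cheeger constant of the complement of a finite set, up to a bounded term. -/
theorem abs_re_inner_coreMap_sub_le_cheegerConst (hq : ∀ x, 0 ≤ q x) (K : Finset V) (φ : Cc V) :
    |(⟪(hasColumns_formalSchrodinger G q).coreMap φ, (φ : ℓ²(V, ℂ))⟫_ℂ).re -
        (⟪(hasColumns_formalMul (degPot G q)).coreMap φ, (φ : ℓ²(V, ℂ))⟫_ℂ).re| ≤
      √(1 - cheegerConst G q ((K : Set V)ᶜ) ^ 2) *
        (⟪(hasColumns_formalMul (degPot G q)).coreMap φ, (φ : ℓ²(V, ℂ))⟫_ℂ).re +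
        2 * (∑ x ∈ K, (G.degree x : ℝ)) * ‖(φ : ℓ²(V, ℂ))‖ ^ 2 := by
  obtain ⟨s, hs⟩ := exists_finset_of_mem_Cc φ.2
  refine (abs_re_inner_coreMap_sub_le G hs).trans ?_
  rw [re_inner_coreMap_formalMul (degPot G q) hs, norm_sq_eq_sum hs]
  exact sum_adjWeight_mul_le G hq K s _ fun x => norm_nonneg _

/-- The two-sided form bounds relating `Δ + q` to `deg + q`. -/
theorem exists_form_bounds (hq : ∀ x, 0 ≤ q x) (hα : 0 < cheegerInfty G q) {ε : ℝ} (hε : 0 < ε) :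
    ∃ k : ℝ, 0 ≤ k ∧ ∀ φ : Cc V,
      (1 - ε) * (1 - √(1 - cheegerInfty G q ^ 2)) *
          (⟪(hasColumns_formalMul (degPot G q)).coreMap φ, (φ : ℓ²(V, ℂ))⟫_ℂ).re ≤
        (⟪(hasColumns_formalSchrodinger G q).coreMap φ, (φ : ℓ²(V, ℂ))⟫_ℂ).re +
          k * ‖(φ : ℓ²(V, ℂ))‖ ^ 2 ∧
      (⟪(hasColumns_formalSchrodinger G q).coreMap φ, (φ : ℓ²(V, ℂ))⟫_ℂ).re ≤
        (1 + ε) * (1 + √(1 - cheegerInfty G q ^ 2)) *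
          (⟪(hasColumns_formalMul (degPot G q)).coreMap φ, (φ : ℓ²(V, ℂ))⟫_ℂ).re +
          k * ‖(φ : ℓ²(V, ℂ))‖ ^ 2 := by
  set α := cheegerInfty G q with hαdef
  have hsqrt : √(1 - α ^ 2) < 1 := by
    rw [Real.sqrt_lt' one_pos]
    nlinarith
  have hsqrt0 := Real.sqrt_nonneg (1 - α ^ 2)
  -- The margin `ε` makes both inequalities strict (the first because `√(1 - α²) < 1`), so they
  -- persist for the Cheeger constant outside some finite `K`.
  have hlt1 : (1 - ε) * (1 - √(1 - α ^ 2)) < 1 - √(1 - α ^ 2) := by nlinarith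
  have hlt2 : 1 + √(1 - α ^ 2) < (1 + ε) * (1 + √(1 - α ^ 2)) := by nlinarith
  have hc1 : Continuous fun β : ℝ => 1 - √(1 - β ^ 2) := by fun_prop
  have hc2 : Continuous fun β : ℝ => 1 + √(1 - β ^ 2) := by fun_prop
  have h1 := hc1.continuousAt.eventually (lt_mem_nhds hlt1)
  have h2 := hc2.continuousAt.eventually (gt_mem_nhds hlt2)
  obtain ⟨K, hK1, hK2⟩ := exists_finset_of_eventually_cheegerInfty G hq (h1.and h2)
  refine ⟨2 * ∑ x ∈ K, (G.degree x : ℝ), by positivity, fun φ => ?_⟩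
  have hD := re_inner_coreMap_formalMul_nonneg (degPot_nonneg G hq) φ
  have hb := abs_le.1 (abs_re_inner_coreMap_sub_le_cheegerConst G hq K φ)
  have e1 := mul_le_mul_of_nonneg_right hK1.le hD
  have e2 := mul_le_mul_of_nonneg_right hK2.le hD
  constructor <;> linarith [hb.1, hb.2]

theorem one_sub_sqrt_cheegerInfty_pos (hα : 0 < cheegerInfty G q) :
    0 < 1 - √(1 - cheegerInfty G q ^ 2) := by
  rw [sub_pos, Real.sqrt_lt' one_pos]
  nlinarith

/-- The form of `Δ + q` controls `deg + q` on the whole domain. -/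
theorem form_lower_bound_schrodinger {R : ℓ²(V, ℂ) →L[ℂ] ℓ²(V, ℂ)}
    (hR : IsNegOneResolvent (schrodinger G q) R) (hq : ∀ x, 0 ≤ q x) {c k : ℝ} (hc : 0 ≤ c)
    (hle : ∀ φ : Cc V,
      c * (⟪(hasColumns_formalMul (degPot G q)).coreMap φ, (φ : ℓ²(V, ℂ))⟫_ℂ).re ≤
        (⟪(hasColumns_formalSchrodinger G q).coreMap φ, (φ : ℓ²(V, ℂ))⟫_ℂ).re +
          k * ‖(φ : ℓ²(V, ℂ))‖ ^ 2)
    (x y : ℓ²(V, ℂ)) (hxy : (x, y) ∈ (schrodinger G q).graph) (s : Finset V) :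
    c * ∑ v ∈ s, degPot G q v * ‖x v‖ ^ 2 ≤ (⟪y, x⟫_ℂ).re + k * ‖x‖ ^ 2 := by
  refine form_lower_bound_of_core hR (hasColumns_formalSchrodinger G q).coreMap
    (hasColumns_formalSchrodinger G q).coreMap_mem_graph
    ((hasColumns_formalSchrodinger G q).denseRange
      (eq_zero_of_mem_graph_formalSchrodinger G hq)) s (fun φ => ?_) hxy
  refine le_trans (mul_le_mul_of_nonneg_left ?_ hc) (hle φ)
  exact sum_le_re_inner_coreMap_formalMul (degPot_nonneg G hq) φ s

end Schrodinger

section MinMax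

variable {H : Type*} [NormedAddCommGroup H] [InnerProductSpace ℂ H]
  {T : H →ₗ.[ℂ] H} {R : H →L[ℂ] H} {ι : Type*} {b : HilbertBasis ι ℂ H} {f : ι → ℝ}

/-! ### The min-max principle -/

theorem hasSum_norm_inner_sq (b : HilbertBasis ι ℂ H) (x : H) :
    HasSum (fun i => ‖⟪b i, x⟫_ℂ‖ ^ 2) (‖x‖ ^ 2) := by
  have h1 := (b.hasSum_inner_mul_inner x x).mapL Complex.reCLM
  have h2 : Complex.reCLM ⟪x, x⟫_ℂ = ‖x‖ ^ 2 := inner_self_eq_norm_sq (𝕜 := ℂ) x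
  rw [h2] at h1
  refine h1.congr_fun fun i => ?_
  rw [← inner_conj_symm x, ← Complex.normSq_eq_conj_mul_self, Complex.normSq_eq_norm_sq]
  rfl

theorem IsNegOneResolvent.hasSum_form (h : IsNegOneResolvent T R)
    (hb : ∀ i, (b i, (f i : ℂ) • b i) ∈ T.graph) {x y : H} (hxy : (x, y) ∈ T.graph) :
    HasSum (fun i => f i * ‖⟪b i, x⟫_ℂ‖ ^ 2) (⟪y, x⟫_ℂ).re := by
  have h1 := (b.hasSum_inner_mul_inner y x).mapL Complex.reCLM
  refine h1.congr_fun fun i => ?_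
  have h2 : ⟪y, b i⟫_ℂ * ⟪b i, x⟫_ℂ = ((f i * ‖⟪b i, x⟫_ℂ‖ ^ 2 : ℝ) : ℂ) := by
    rw [← inner_conj_symm y, h.inner_eigenbasis hb hxy, map_mul, Complex.conj_ofReal, mul_assoc,
      ← Complex.normSq_eq_conj_mul_self, Complex.normSq_eq_norm_sq, ← Complex.ofReal_mul]
  rw [h2]
  rfl

theorem IsNegOneResolvent.mul_norm_sq_le (h : IsNegOneResolvent T R)
    (hb : ∀ i, (b i, (f i : ℂ) • b i) ∈ T.graph) {x y : H} (hxy : (x, y) ∈ T.graph) {c : ℝ}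
    (hc : ∀ i, ⟪b i, x⟫_ℂ ≠ 0 → c ≤ f i) : c * ‖x‖ ^ 2 ≤ (⟪y, x⟫_ℂ).re := by
  refine hasSum_le (fun i => ?_) ((hasSum_norm_inner_sq b x).mul_left c) (h.hasSum_form hb hxy)
  by_cases h0 : ⟪b i, x⟫_ℂ = 0
  · simp [h0]
  · exact mul_le_mul_of_nonneg_right (hc i h0) (sq_nonneg _)

theorem IsNegOneResolvent.le_mul_norm_sq (h : IsNegOneResolvent T R)
    (hb : ∀ i, (b i, (f i : ℂ) • b i) ∈ T.graph) {x y : H} (hxy : (x, y) ∈ T.graph) {c : ℝ}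
    (hc : ∀ i, ⟪b i, x⟫_ℂ ≠ 0 → f i ≤ c) : (⟪y, x⟫_ℂ).re ≤ c * ‖x‖ ^ 2 := by
  refine hasSum_le (fun i => ?_) (h.hasSum_form hb hxy) ((hasSum_norm_inner_sq b x).mul_left c)
  by_cases h0 : ⟪b i, x⟫_ℂ = 0
  · simp [h0]
  · exact mul_le_mul_of_nonneg_right (hc i h0) (sq_nonneg _)

/-- The span of `n + 1` orthonormal vectors contains a non-zero vector orthogonal to `n` given
vectors. -/
theorem exists_ne_zero_mem_span_inner_eq_zero {v : ℕ → H} (hv : Orthonormal ℂ v) (w : ℕ → H)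
    (n : ℕ) : ∃ x ≠ 0, x ∈ Submodule.span ℂ (v '' Set.Iic n) ∧ ∀ j < n, ⟪w j, x⟫_ℂ = 0 := by
  set V := Submodule.span ℂ (v '' Set.Iic n) with hV
  have hfin : (v '' Set.Iic n).Finite := (Set.finite_Iic n).image v
  have : FiniteDimensional ℂ V := FiniteDimensional.span_of_finite ℂ hfin
  have hli : LinearIndependent ℂ (fun i : Fin (n + 1) => v i) :=
    hv.linearIndependent.comp _ Fin.val_injective
  have hrange : Set.range (fun i : Fin (n + 1) => v i) = v '' Set.Iic n := by
    ext y
    constructor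
    · rintro ⟨i, rfl⟩
      exact ⟨i, Nat.lt_succ_iff.1 i.2, rfl⟩
    · rintro ⟨i, hi, rfl⟩
      exact ⟨⟨i, Nat.lt_succ_iff.2 hi⟩, rfl⟩
  have hrank : Module.finrank ℂ V = n + 1 := by
    rw [hV, ← hrange, finrank_span_eq_card hli, Fintype.card_fin]
  set F : V →ₗ[ℂ] (Fin n → ℂ) :=
    LinearMap.pi fun j => ((innerSL ℂ (w j) : H →L[ℂ] ℂ) : H →ₗ[ℂ] ℂ) ∘ₗ V.subtype with hF
  -- `n` linear conditions on a space of dimension `n + 1`.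
  have hker : LinearMap.ker F ≠ ⊥ := LinearMap.ker_ne_bot_of_finrank_lt (by
    rw [hrank, Module.finrank_fin_fun]; exact Nat.lt_succ_self n)
  obtain ⟨x, hx, hx0⟩ := Submodule.exists_mem_ne_zero_of_ne_bot hker
  refine ⟨x, fun h => hx0 (Subtype.ext h), x.2, fun j hj => ?_⟩
  exact congrFun (LinearMap.mem_ker.1 hx) ⟨j, hj⟩

theorem inner_eq_zero_of_mem_span {v : ℕ → H} (hv : Orthonormal ℂ v) {n m : ℕ} (hnm : n < m)
    {x : H} (hx : x ∈ Submodule.span ℂ (v '' Set.Iic n)) : ⟪v m, x⟫_ℂ = 0 := by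
  have : Submodule.span ℂ (v '' Set.Iic n) ≤
      LinearMap.ker ((innerSL ℂ (v m) : H →L[ℂ] ℂ) : H →ₗ[ℂ] ℂ) := by
    rw [Submodule.span_le]
    rintro _ ⟨i, hi, rfl⟩
    have hi : i ≤ n := hi
    exact hv.2 (hi.trans_lt hnm).ne'
  exact this hx

theorem tendsto_comp_equiv_atTop {ι : Type*} {f : ι → ℝ} (hf : ∀ c, {i | f i ≤ c}.Finite)
    (e : ℕ ≃ ι) : Tendsto (f ∘ e) atTop atTop := by
  rw [← Nat.cofinite_eq_atTop, tendsto_atTop]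
  intro c
  rw [eventually_cofinite]
  refine ((hf c).preimage e.injective.injOn).subset fun n hn => ?_
  exact (not_le.1 hn).le

theorem tendsto_div_of_forall_affine_bounds {u v : ℕ → ℝ} (hv : Tendsto v atTop atTop)
    (h : ∀ ε : ℝ, 0 < ε → ε < 1 → ∃ k : ℝ, ∀ n, (1 - ε) * v n ≤ u n + k ∧
      u n ≤ (1 + ε) * v n + k) : Tendsto (fun n => u n / v n) atTop (𝓝 1) := by
  rw [Metric.tendsto_atTop']
  intro δ hδ
  -- Once `v n ≥ 4k / δ`, the terms `ε v n` and `k` are each at most `(δ / 4) v n`, which leaves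
  -- room below `δ v n`.
  set ε := min (δ / 4) (1 / 2) with hε
  have hε0 : 0 < ε := by positivity
  have hε1 : ε < 1 := (min_le_right _ _).trans_lt (by norm_num)
  have hεδ : ε ≤ δ / 4 := min_le_left _ _
  obtain ⟨k, hk⟩ := h ε hε0 hε1
  obtain ⟨N, hN⟩ := (eventually_atTop.1 ((hv.eventually_gt_atTop 0).and
    (hv.eventually_ge_atTop (4 * k / δ))))
  refine ⟨N, fun n hn => ?_⟩
  obtain ⟨h1, h2⟩ := hN n hn.le
  rw [div_le_iff₀ hδ] at h2
  obtain ⟨h3, h4⟩ := hk n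
  have h5 : ε * v n ≤ δ / 4 * v n := mul_le_mul_of_nonneg_right hεδ h1.le
  have h6 : 0 < δ * v n := mul_pos hδ h1
  rw [Real.dist_eq, abs_lt]
  constructor
  · rw [lt_sub_iff_add_lt, lt_div_iff₀ h1]
    linarith
  · rw [sub_lt_iff_lt_add, div_lt_iff₀ h1]
    linarith

end MinMax

section MainResults

variable {V : Type*} (G : SimpleGraph V) [G.LocallyFinite] {q : V → ℝ}

/-! ### Spectral properties of Schrödinger operators -/

theorem liminfInfty_eq_top_iff {g : V → ℝ} :
    liminfInfty g = ⊤ ↔ ∀ c, {x | g x ≤ c}.Finite := by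
  constructor
  · intro h c
    have h1 : (c : EReal) < liminfInfty g := by rw [h]; exact EReal.coe_lt_top c
    obtain ⟨W, hW⟩ := lt_iSup_iff.1 h1
    refine W.finite_toSet.subset fun x hx => ?_
    by_contra hxW
    have h2 := hW.trans_le (iInf_le _ ⟨x, hxW⟩)
    exact absurd hx (not_le.2 (EReal.coe_lt_coe_iff.1 h2))
  · intro h
    rw [EReal.eq_top_iff_forall_lt]
    intro c
    refine lt_of_lt_of_le (EReal.coe_lt_coe_iff.2 (lt_add_one c))
      (le_iSup_of_le (h (c + 1)).toFinset (le_iInf fun x => ?_))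
    have h1 : ¬ g x ≤ c + 1 := by simpa using x.2
    exact EReal.coe_le_coe_iff.2 (not_le.1 h1).le

theorem orthonormal_stdVec : Orthonormal ℂ (stdVec : V → ℓ²(V, ℂ)) := by
  have := (stdHilbertBasis V).orthonormal
  rwa [show (⇑(stdHilbertBasis V) : V → ℓ²(V, ℂ)) = stdVec from
    funext stdHilbertBasis_apply] at this

theorem exists_resolvent_schrodinger (hq : ∀ x, 0 ≤ q x) :
    ∃ R, IsNegOneResolvent (schrodinger G q) R :=
  (hasColumns_formalSchrodinger G q).exists_resolvent
    (eq_zero_of_mem_graph_formalSchrodinger G hq)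
    (re_inner_coreMap_formalSchrodinger_nonneg G hq)

theorem exists_resolvent_degOperator (hq : ∀ x, 0 ≤ q x) :
    ∃ R, IsNegOneResolvent (degOperator G q) R :=
  (hasColumns_formalMul (degPot G q)).exists_resolvent
    (eq_zero_of_mem_graph_formalMul (degPot_nonneg G hq))
    (re_inner_coreMap_formalMul_nonneg (degPot_nonneg G hq))

/-- Here `stdVec x = R ((T + 1) stdVec x)`, and `‖(T + 1) stdVec x‖ ≤ 1 + 2c` when `(deg + q)(x) ≤
c`: the diagonal entry and the at most `c` neighbours each account for `c`. Compactness allows only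
finitely many such `x`. -/
theorem finite_setOf_degPot_le {R : ℓ²(V, ℂ) →L[ℂ] ℓ²(V, ℂ)} (hq : ∀ x, 0 ≤ q x)
    (hR : IsNegOneResolvent (schrodinger G q) R) (hc : IsCompactOperator R) (c : ℝ) :
    {x | degPot G q x ≤ c}.Finite := by
  refine finite_of_orthonormal_image hc orthonormal_stdVec
    (fun x => stdVec x + schrodingerCol G q x) (M := 1 + (c + c)) (fun x hx => ?_) fun x _ => ?_
  · have hx : degPot G q x ≤ c := hx
    have h1 : ∀ y : V, ‖(stdVec y : ℓ²(V, ℂ))‖ = 1 := orthonormal_stdVec.1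
    have h2 : ‖(degPot G q x : ℂ) • (stdVec x : ℓ²(V, ℂ))‖ ≤ c := by
      rw [norm_smul, h1, mul_one, Complex.norm_real, Real.norm_eq_abs,
        abs_of_nonneg (degPot_nonneg G hq x)]
      exact hx
    have h3 : ‖∑ y ∈ G.neighborFinset x, (stdVec y : ℓ²(V, ℂ))‖ ≤ c := by
      refine (norm_sum_le_of_le _ fun y _ => (h1 y).le).trans ?_
      rw [Finset.sum_const, G.card_neighborFinset_eq_degree, nsmul_eq_mul, mul_one]
      exact le_trans (le_add_of_nonneg_right (hq x)) hx
    refine (norm_add_le _ _).trans (add_le_add (h1 x).le ?_)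
    exact (norm_sub_le _ _).trans (add_le_add h2 h3)
  · exact (hR.mem_graph_iff _ _).1
      (mem_graph_maximalOperator.2 ((hasColumns_formalSchrodinger G q).apply_stdVec x))

theorem isCompactOperator_resolvent_schrodinger {R : ℓ²(V, ℂ) →L[ℂ] ℓ²(V, ℂ)}
    (hq : ∀ x, 0 ≤ q x) (hα : 0 < cheegerInfty G q)
    (hR : IsNegOneResolvent (schrodinger G q) R) (hfin : ∀ c, {x | degPot G q x ≤ c}.Finite) :
    IsCompactOperator R := by
  obtain ⟨k, hk, hle⟩ := exists_form_bounds G hq hα (ε := 1 / 2) (by norm_num)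
  have hc : 0 < (1 - 1 / 2) * (1 - √(1 - cheegerInfty G q ^ 2)) :=
    mul_pos (by norm_num) (one_sub_sqrt_cheegerInfty_pos G hα)
  exact isCompactOperator_of_form_lower_bound hR hc hk (degPot_nonneg G hq) hfin
    (form_lower_bound_schrodinger G hR hq hc.le fun φ => (hle φ).1)

theorem isCompactOperator_resolvent_degOperator {R : ℓ²(V, ℂ) →L[ℂ] ℓ²(V, ℂ)}
    (hq : ∀ x, 0 ≤ q x) (hR : IsNegOneResolvent (degOperator G q) R)
    (hfin : ∀ c, {x | degPot G q x ≤ c}.Finite) : IsCompactOperator R := by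
  have hg := degPot_nonneg G hq
  refine isCompactOperator_of_form_lower_bound hR one_pos le_rfl hg hfin fun x y hxy s => ?_
  refine form_lower_bound_of_core hR (hasColumns_formalMul (degPot G q)).coreMap
    (hasColumns_formalMul (degPot G q)).coreMap_mem_graph
    ((hasColumns_formalMul (degPot G q)).denseRange (eq_zero_of_mem_graph_formalMul hg)) s
    (fun φ => ?_) hxy
  rw [one_mul, zero_mul, add_zero]
  exact sum_le_re_inner_coreMap_formalMul hg φ s

theorem formLE_of_forall_coreMap {L₁ L₂ : (V → ℂ) →ₗ[ℂ] (V → ℂ)} {col₁ col₂ : V → ℓ²(V, ℂ)}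
    (h₁ : HasColumns L₁ col₁) (h₂ : HasColumns L₂ col₂) {c₁ k₁ c₂ k₂ : ℝ}
    (h : ∀ φ : Cc V,
      c₁ * (⟪h₁.coreMap φ, (φ : ℓ²(V, ℂ))⟫_ℂ).re + k₁ * ‖(φ : ℓ²(V, ℂ))‖ ^ 2 ≤
        c₂ * (⟪h₂.coreMap φ, (φ : ℓ²(V, ℂ))⟫_ℂ).re + k₂ * ‖(φ : ℓ²(V, ℂ))‖ ^ 2) :
    FormLE (Cc V) (affine c₁ (maximalOperator L₁) k₁) (affine c₂ (maximalOperator L₂) k₂) := by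
  have key : ∀ (z w : ℓ²(V, ℂ)) (c k : ℝ), (⟪(c : ℂ) • z + (k : ℂ) • w, w⟫_ℂ).re =
      c * (⟪z, w⟫_ℂ).re + k * ‖w‖ ^ 2 := by
    intro z w c k
    have hw : (⟪w, w⟫_ℂ).re = ‖w‖ ^ 2 := inner_self_eq_norm_sq (𝕜 := ℂ) w
    rw [inner_add_left, inner_smul_left, inner_smul_left, Complex.conj_ofReal,
      Complex.conj_ofReal, Complex.add_re, Complex.re_ofReal_mul, Complex.re_ofReal_mul, hw]
  intro φ hφ
  refine ⟨h₁.Cc_le_domain hφ, h₂.Cc_le_domain hφ, ?_⟩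
  have h3 := h ⟨φ, hφ⟩
  rw [← key, ← key] at h3
  exact h3

theorem affine_one_zero {H : Type*} [NormedAddCommGroup H] [InnerProductSpace ℂ H]
    (T : H →ₗ.[ℂ] H) : affine 1 T 0 = T := by
  refine LinearPMap.ext rfl fun x hx _ => ?_
  change ((1 : ℝ) : ℂ) • T ⟨x, hx⟩ + ((0 : ℝ) : ℂ) • x = T ⟨x, hx⟩
  simp

/-- The eigenvalues of `Δ + q` and `deg + q` are asymptotically equal if the Cheeger constant at
infinity is `1`. -/
theorem exists_eigenvalueSequences [Infinite V] (hq : ∀ x, 0 ≤ q x)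
    (hα : cheegerInfty G q = 1) (hfin : ∀ c, {x | degPot G q x ≤ c}.Finite) :
    ∃ ev₁ ev₂ : ℕ → ℝ, IsEigenvalueSequence (schrodinger G q) ev₁ ∧
      IsEigenvalueSequence (degOperator G q) ev₂ ∧
      Tendsto (fun n => ev₁ n / ev₂ n) atTop (𝓝 1) := by
  have hα0 : 0 < cheegerInfty G q := by rw [hα]; exact one_pos
  obtain ⟨R, hR⟩ := exists_resolvent_schrodinger G hq
  obtain ⟨R', hR'⟩ := exists_resolvent_degOperator G hq
  have hc := isCompactOperator_resolvent_schrodinger G hq hα0 hR hfin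
  have hc' := isCompactOperator_resolvent_degOperator G hq hR' hfin
  obtain ⟨ι, b, f, hb, hf⟩ := hR.exists_eigenbasis hc
  have hb' := stdHilbertBasis_mem_graph (degPot G q)
  have : Infinite ι := by
    by_contra hι
    have : Finite ι := not_infinite_iff_finite.1 hι
    have : Fintype ι := Fintype.ofFinite ι
    have h1 : FiniteDimensional ℂ ℓ²(V, ℂ) := Module.Basis.finiteDimensional_of_finite
      b.toOrthonormalBasis.toBasis
    exact Set.infinite_univ (α := V)
      (Set.finite_univ_iff.2 (LinearIndependent.finite orthonormal_stdVec.linearIndependent))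
  obtain ⟨e₁, he₁⟩ := exists_equiv_nat_monotone hf
  obtain ⟨e₂, he₂⟩ := exists_equiv_nat_monotone hfin
  refine ⟨f ∘ e₁, degPot G q ∘ e₂, hR.isEigenvalueSequence hc hb hf e₁ he₁,
    hR'.isEigenvalueSequence hc' hb' hfin e₂ he₂, ?_⟩
  refine tendsto_div_of_forall_affine_bounds (tendsto_comp_equiv_atTop hfin e₂)
    fun ε hε hε1 => ?_
  obtain ⟨k, hk, hle⟩ := exists_form_bounds G hq hα0 hε
  have hsqrt : √(1 - cheegerInfty G q ^ 2) = 0 := by rw [hα]; simp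
  rw [hsqrt, sub_zero, add_zero, mul_one, mul_one] at hle
  have hv₁ : Orthonormal ℂ (b ∘ e₁) := b.orthonormal.comp _ e₁.injective
  have hv₂ : Orthonormal ℂ ((stdVec : V → ℓ²(V, ℂ)) ∘ e₂) :=
    orthonormal_stdVec.comp _ e₂.injective
  refine ⟨k, fun n => ⟨?_, ?_⟩⟩
  -- Min-max with a trial vector in the span of the first `n + 1` eigenvectors of `Δ + q`,
  -- orthogonal to the first `n` basis vectors. Its `Δ + q` energy is at most `λ_n(Δ + q) ‖x‖²` and
  -- its `deg + q` energy at least `λ_n(deg + q) ‖x‖²`.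
  · obtain ⟨x, hx0, hx, hxw⟩ := exists_ne_zero_mem_span_inner_eq_zero hv₁
      ((stdVec : V → ℓ²(V, ℂ)) ∘ e₂) n
    have hdom : x ∈ (schrodinger G q).domain := by
      refine (Submodule.span_le.2 ?_ : Submodule.span ℂ ((b ∘ e₁) '' Set.Iic n) ≤ _) hx
      rintro _ ⟨i, -, rfl⟩
      exact LinearPMap.mem_domain_of_mem_graph (hb (e₁ i))
    have hgr := (schrodinger G q).mem_graph ⟨x, hdom⟩
    have hup := hR.le_mul_norm_sq hb hgr (c := f (e₁ n)) fun i hi => by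
      obtain ⟨m, rfl⟩ := e₁.surjective i
      have hm : m ≤ n := by
        by_contra hlt
        exact hi (inner_eq_zero_of_mem_span hv₁ (not_le.1 hlt) hx)
      exact he₁ hm
    have hlow := form_lower_bound_schrodinger G hR hq (sub_nonneg.2 hε1.le)
      (fun φ => (hle φ).1) _ _ hgr
    have hsum : (1 - ε) * degPot G q (e₂ n) * ‖x‖ ^ 2 ≤
        (⟪schrodinger G q ⟨x, hdom⟩, x⟫_ℂ).re + k * ‖x‖ ^ 2 := by
      have h1 := (hasSum_norm_inner_sq (stdHilbertBasis V) x).mul_left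
        ((1 - ε) * degPot G q (e₂ n))
      refine hasSum_le_of_sum_le h1 fun s => le_trans ?_ (hlow s)
      rw [Finset.mul_sum]
      refine Finset.sum_le_sum fun v _ => ?_
      rw [stdHilbertBasis_apply, inner_stdVec_left, mul_assoc]
      refine mul_le_mul_of_nonneg_left ?_ (sub_nonneg.2 hε1.le)
      obtain ⟨m, rfl⟩ := e₂.surjective v
      rcases lt_or_ge m n with hmn | hmn
      · have h2 := hxw m hmn
        rw [Function.comp_apply, inner_stdVec_left] at h2
        rw [h2]; simp
      · exact mul_le_mul_of_nonneg_right (he₂ hmn) (sq_nonneg _)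
    have hpos : 0 < ‖x‖ ^ 2 := by
      have := norm_pos_iff.2 hx0
      positivity
    refine le_of_mul_le_mul_right ?_ hpos
    simp only [Function.comp_apply]
    rw [add_mul]
    exact hsum.trans (by linarith)
  -- The same with the roles exchanged; the trial vector is now finitely supported, so the upper
  -- form bound applies on the core directly.
  · obtain ⟨x, hx0, hx, hxw⟩ := exists_ne_zero_mem_span_inner_eq_zero hv₂ (b ∘ e₁) n
    have hxC : x ∈ Cc V := by
      refine (Submodule.span_le.2 ?_ :
        Submodule.span ℂ (((stdVec : V → ℓ²(V, ℂ)) ∘ e₂) '' Set.Iic n) ≤ _) hx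
      rintro _ ⟨i, -, rfl⟩
      exact stdVec_mem_Cc _
    have hlow := hR.mul_norm_sq_le hb
      ((hasColumns_formalSchrodinger G q).coreMap_mem_graph ⟨x, hxC⟩) (c := f (e₁ n))
      fun i hi => by
        obtain ⟨m, rfl⟩ := e₁.surjective i
        have hm : n ≤ m := by
          by_contra hlt
          exact hi (hxw m (not_le.1 hlt))
        exact he₁ hm
    have hup := hR'.le_mul_norm_sq hb'
      ((hasColumns_formalMul (degPot G q)).coreMap_mem_graph ⟨x, hxC⟩) (c := degPot G q (e₂ n))
      fun i hi => by
        obtain ⟨m, rfl⟩ := e₂.surjective i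
        rw [stdHilbertBasis_apply] at hi
        have hm : m ≤ n := by
          by_contra hlt
          exact hi (inner_eq_zero_of_mem_span hv₂ (not_le.1 hlt) hx)
        exact he₂ hm
    have hmid := (hle ⟨x, hxC⟩).2
    have hup' := mul_le_mul_of_nonneg_left hup (by linarith : (0 : ℝ) ≤ 1 + ε)
    have hpos : 0 < ‖x‖ ^ 2 := by
      have := norm_pos_iff.2 hx0
      positivity
    refine le_of_mul_le_mul_right ?_ hpos
    simp only [Function.comp_apply]
    rw [add_mul, mul_assoc]
    exact hlow.trans (hmid.trans (by linarith))

end MainResults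

end SchrodingerGraph

open SchrodingerGraph
theorem theoremt {V : Type*} [Countable V] (G : SimpleGraph V) [G.LocallyFinite]
    (q : V → ℝ) (hq : ∀ x, 0 ≤ q x) (hα : 0 < cheegerInfty G q) :
    -- (a) two-sided form bounds on the finitely supported functions
    (∀ ε : ℝ, 0 < ε → ∃ k : ℝ, 0 ≤ k ∧
      FormLE (Cc V)
        (affine ((1 - ε) * (1 - √(1 - cheegerInfty G q ^ 2))) (degOperator G q) (-k))
        (schrodinger G q) ∧
      FormLE (Cc V)
        (schrodinger G q)
        (affine ((1 + ε) * (1 + √(1 - cheegerInfty G q ^ 2))) (degOperator G q) k)) ∧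
    -- (b) the square roots exist and have the same domain
    ((∃ S, IsPosSqrt S (schrodinger G q)) ∧ (∃ S, IsPosSqrt S (degOperator G q)) ∧
      ∀ S₁ S₂, IsPosSqrt S₁ (schrodinger G q) → IsPosSqrt S₂ (degOperator G q) →
        S₁.domain = S₂.domain) ∧
    -- (c) discreteness of the spectrum and eigenvalue asymptotics
    (HasPurelyDiscreteSpectrum (schrodinger G q) ↔ liminfInfty (degPot G q) = ⊤) ∧
    (Infinite V → HasPurelyDiscreteSpectrum (schrodinger G q) → cheegerInfty G q = 1 →
      ∃ ev₁ ev₂ : ℕ → ℝ, IsEigenvalueSequence (schrodinger G q) ev₁ ∧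
        IsEigenvalueSequence (degOperator G q) ev₂ ∧
        Filter.Tendsto (fun n => ev₁ n / ev₂ n) Filter.atTop (nhds 1)) := by
  have hcs := hasColumns_formalSchrodinger G q
  have hcm := hasColumns_formalMul (degPot G q)
  obtain ⟨R, hR⟩ := exists_resolvent_schrodinger G hq
  obtain ⟨R', hR'⟩ := exists_resolvent_degOperator G hq
  refine ⟨fun ε hε => ?_, ⟨exists_isPosSqrt hR, exists_isPosSqrt hR', fun S₁ S₂ h₁ h₂ => ?_⟩,
    ?_, fun hV hd hα1 => ?_⟩
  · obtain ⟨k, hk, hle⟩ := exists_form_bounds G hq hα hε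
    refine ⟨k, hk, ?_, ?_⟩
    · rw [← affine_one_zero (schrodinger G q)]
      exact formLE_of_forall_coreMap hcm hcs fun φ => by linarith [(hle φ).1]
    · conv => enter [2]; rw [← affine_one_zero (schrodinger G q)]
      exact formLE_of_forall_coreMap hcs hcm fun φ => by linarith [(hle φ).2]
  · obtain ⟨k, hk, hle⟩ := exists_form_bounds G hq hα (ε := 1 / 2) (by norm_num)
    set c₁ := (1 - 1 / 2) * (1 - √(1 - cheegerInfty G q ^ 2)) with hc₁
    set c₂ := (1 + 1 / 2) * (1 + √(1 - cheegerInfty G q ^ 2)) with hc₂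
    have hc₁0 : 0 < c₁ := mul_pos (by norm_num) (one_sub_sqrt_cheegerInfty_pos G hα)
    have hc₂0 : 0 ≤ c₂ := by positivity
    have hds := hcs.denseRange (eq_zero_of_mem_graph_formalSchrodinger G hq)
    have hdm := hcm.denseRange (eq_zero_of_mem_graph_formalMul (degPot_nonneg G hq))
    apply le_antisymm
    · refine h₁.domain_le h₂ hcs.coreMap hcm.coreMap hcs.coreMap_mem_graph hcm.coreMap_mem_graph
        -- From `c₁ ⟪D φ, φ⟫ ≤ Q + k ‖φ‖² ≤ (1 + k)(Q + ‖φ‖²)`, where `Q ≥ 0` is the form of `Δ +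
        -- q`.
        hds (M := (1 + k) / c₁) (by positivity) fun φ => ?_
      rw [div_mul_eq_mul_div, le_div_iff₀ hc₁0]
      have h3 := re_inner_coreMap_formalSchrodinger_nonneg G hq φ
      nlinarith [(hle φ).1, sq_nonneg ‖(φ : ℓ²(V, ℂ))‖, mul_nonneg hk h3]
    · refine h₂.domain_le h₁ hcm.coreMap hcs.coreMap hcm.coreMap_mem_graph hcs.coreMap_mem_graph
        hdm (M := c₂ + k) (by positivity) fun φ => ?_
      have h3 := re_inner_coreMap_formalMul_nonneg (degPot_nonneg G hq) φ
      nlinarith [(hle φ).2, mul_nonneg hc₂0 (sq_nonneg ‖(φ : ℓ²(V, ℂ))‖), mul_nonneg hk h3]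
  · rw [liminfInfty_eq_top_iff]
    constructor
    · intro hd
      exact finite_setOf_degPot_le G hq hR (hR.isCompactOperator hd)
    · intro hfin
      exact hR.hasPurelyDiscreteSpectrum (isCompactOperator_resolvent_schrodinger G hq hα hR hfin)
  · exact exists_eigenvalueSequences G hq hα1
      (finite_setOf_degPot_le G hq hR (hR.isCompactOperator hd))
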